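/- An additively idempotent semiring (ai-semiring) is a nonempty algebra $(S,+,\cdot)$ such that $(S,+)$ is a commutative idempotent semigroup, $(S,\cdot)$ is a semigroup, and $x(y+z)=xy+xz$, $(x+y)z=xz+yz$ hold for all $x,y,z\in S$ (no neutral elements are required). A variety of ai-semirings is a class of ai-semirings closed under (isomorphic copies of) subalgebras, homomorphic images and arbitrary direct products; $\mathsf{V}(S)$ denotes the smallest variety containing $S$. A variety is finitely based if it is the class of all ai-semirings satisfying some finite set of identities, and nonfinitely based otherwise. A limit variety is a nonfinitely based variety all of whose proper subvarieties are finitely based. Let $SR_6=\{1,2,3,4,5,6\}$ be the commutative ai-semiring with $x+x=x$ for all $x$, $2+5=5+2=2$, $4+6=6+4=4$ and $x+y=1$ in all other cases, and with $2\cdot 6=6\cdot 2=4\cdot 5=5\cdot 4=5\cdot 6=6\cdot 5=3$ and $x\cdot y=1$ in all other cases. For a nonempty commutative word $\mathbf{w}$ (an element of a free commutative semigroup), let $S_c(\mathbf{w})$ be the set of all nonempty subwords of $\mathbf{w}$ together with a new symbol $0$, where $\mathbf{u}+\mathbf{u}=\mathbf{u}$ and every other sum is $0$, and where the product of two words $\mathbf{u},\mathbf{v}$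 is $\mathbf{u}\mathbf{v}$ if this is a subword of $\mathbf{w}$, and every other product is $0$. Let $a,b$ be distinct letters, and let $\mathbf{T}$ be the trivial variety, that is, the class of all one-element ai-semirings. Theorem. $\mathsf{V}(SR_6)$ is a limit variety: it is nonfinitely based, while each of its proper subvarieties is finitely based. Moreover, its proper subvarieties are exactly $\mathbf{T}$, $\mathsf{V}(S_c(a))$ and $\mathsf{V}(S_c(ab))$, and $$\mathbf{T}\subsetneq \mathsf{V}(S_c(a))\subsetneq \mathsf{V}(S_c(ab))\subsetneq \mathsf{V}(SR_6).$$ -/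

import Mathlib

universe u

/-- An additively idempotent semiring: a commutative idempotent additive semigroup and a
multiplicative semigroup linked by the two distributive laws. Neither an additive nor a
multiplicative neutral element is required, and multiplication need not commute. -/
class AISemiring (S : Type u) extends AddCommSemigroup S, Semigroup S, Distrib S where
  add_self : ∀ a : S, a + a = a

/-- A (nonempty) ai-semiring together with its carrier. -/
structure AISemiringAlg : Type (u + 1) where
  carrier : Type u
  [str : AISemiring carrier]
  [nonempty : Nonempty carrier]

attribute [instance] AISemiringAlg.str AISemiringAlg.nonempty

instance : CoeSort AISemiringAlg.{u} (Type u) := ⟨AISemiringAlg.carrier⟩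

instance AISemiring.pi {ι : Type u} (S : ι → Type u) [∀ i, AISemiring (S i)] :
    AISemiring (∀ i, S i) :=
  { (inferInstance : AddCommSemigroup (∀ i, S i)),
    (inferInstance : Semigroup (∀ i, S i)),
    (inferInstance : Distrib (∀ i, S i)) with
    add_self := fun a => funext fun i => AISemiring.add_self (a i) }

/-- The direct product of a family of ai-semirings, with componentwise operations. -/
def AISemiringAlg.prod {ι : Type u} (A : ι → AISemiringAlg.{u}) : AISemiringAlg.{u} where
  carrier := ∀ i, A i

/-- Semiring homomorphisms: maps that preserve addition and multiplication. -/
def IsSemiringHom {S T : Type u} [Add S] [Mul S] [Add T] [Mul T] (f : S → T) : Prop :=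
  (∀ x y, f (x + y) = f x + f y) ∧ (∀ x y, f (x * y) = f x * f y)

/-- A variety of ai-semirings: a class of ai-semirings closed under (isomorphic copies of)
subalgebras, homomorphic images and arbitrary direct products. -/
@[ext]
structure AIVariety : Type (u + 1) where
  carrier : Set AISemiringAlg.{u}
  sub_mem : ∀ {A B : AISemiringAlg.{u}} (f : B → A), IsSemiringHom f → Function.Injective f →
    A ∈ carrier → B ∈ carrier
  image_mem : ∀ {A B : AISemiringAlg.{u}} (f : A → B), IsSemiringHom f → Function.Surjective f →
    A ∈ carrier → B ∈ carrier
  prod_mem : ∀ {ι : Type u} (A : ι → AISemiringAlg.{u}), (∀ i, A i ∈ carrier) →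
    AISemiringAlg.prod A ∈ carrier

/-- Varieties are ordered by inclusion. -/
instance : PartialOrder AIVariety.{u} :=
  PartialOrder.lift AIVariety.carrier fun _ _ h => AIVariety.ext h

/-- The variety generated by `A`: the intersection of all varieties that contain `A`. -/
def AIVariety.generatedBy (A : AISemiringAlg.{u}) : AIVariety.{u} where
  carrier := {B | ∀ V : AIVariety.{u}, A ∈ V.carrier → B ∈ V.carrier}
  sub_mem f hf hi hA V hV := V.sub_mem f hf hi (hA V hV)
  image_mem f hf hs hA V hV := V.image_mem f hf hs (hA V hV)
  prod_mem A hA V hV := V.prod_mem A fun i => hA i V hV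

/-- The trivial variety: the class of all one-element ai-semirings. -/
def AIVariety.trivial : AIVariety.{u} where
  carrier := {A | Subsingleton A}
  sub_mem := fun _ _ hi hA =>
    haveI : Subsingleton _ := hA
    hi.subsingleton
  image_mem := fun _ _ hs hA =>
    haveI : Subsingleton _ := hA
    hs.subsingleton
  prod_mem := fun _ hA => ⟨fun x y => funext fun i =>
    haveI : Subsingleton _ := hA i
    Subsingleton.elim (x i) (y i)⟩

/-- Terms in the two binary operation symbols over a countably infinite set of variables. -/
inductive AITerm : Type
  | var : ℕ → AITerm
  | add : AITerm → AITerm → AITerm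
  | mul : AITerm → AITerm → AITerm

/-- The value of a term under an assignment of the variables. -/
def AITerm.eval {S : Type u} [Add S] [Mul S] (v : ℕ → S) : AITerm → S
  | .var n => v n
  | .add s t => s.eval v + t.eval v
  | .mul s t => s.eval v * t.eval v

/-- `S` satisfies the identity `p.1 ≈ p.2`. -/
def SatisfiesIdentity (S : Type u) [Add S] [Mul S] (p : AITerm × AITerm) : Prop :=
  ∀ v : ℕ → S, p.1.eval v = p.2.eval v

/-- A variety of ai-semirings is finitely based if it is the class of all ai-semirings that
satisfy some finite set of identities. -/
def AIVariety.IsFinitelyBased (V : AIVariety.{u}) : Prop :=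
  ∃ E : Set (AITerm × AITerm), E.Finite ∧
    ∀ A : AISemiringAlg.{u}, A ∈ V.carrier ↔ ∀ p ∈ E, SatisfiesIdentity A p

/-- A limit variety: nonfinitely based, but every proper subvariety is finitely based. -/
def AIVariety.IsLimit (V : AIVariety.{u}) : Prop :=
  ¬ V.IsFinitelyBased ∧ ∀ W : AIVariety.{u}, W < V → W.IsFinitelyBased

/-- The six elements `1, …, 6` of `SR₆`. -/
inductive SR6 : Type u
  | e1 | e2 | e3 | e4 | e5 | e6

namespace SR6

/-- Addition table: the diagonal entries, `2 + 5 = 2` and `4 + 6 = 4`; every other sum is `1`. -/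
def add : SR6.{u} → SR6.{u} → SR6.{u}
  | e2, e2 => e2
  | e2, e5 => e2
  | e3, e3 => e3
  | e4, e4 => e4
  | e4, e6 => e4
  | e5, e2 => e2
  | e5, e5 => e5
  | e6, e4 => e4
  | e6, e6 => e6
  | _, _ => e1

/-- Multiplication table: `2 · 6 = 4 · 5 = 5 · 6 = 3`, symmetrically; every other product
is `1`. -/
def mul : SR6.{u} → SR6.{u} → SR6.{u}
  | e2, e6 => e3
  | e4, e5 => e3
  | e5, e4 => e3
  | e5, e6 => e3
  | e6, e2 => e3
  | e6, e5 => e3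
  | _, _ => e1

instance : AISemiring SR6.{u} where
  add := add
  mul := mul
  add_assoc := by rintro (_ | _) (_ | _) (_ | _) <;> rfl
  add_comm := by rintro (_ | _) (_ | _) <;> rfl
  mul_assoc := by rintro (_ | _) (_ | _) (_ | _) <;> rfl
  left_distrib := by rintro (_ | _) (_ | _) (_ | _) <;> rfl
  right_distrib := by rintro (_ | _) (_ | _) (_ | _) <;> rfl
  add_self := by rintro (_ | _) <;> rfl

theorem mul_comm (x y : SR6.{u}) : x * y = y * x := by
  cases x <;> cases y <;> rfl

/-- `SR₆` as an ai-semiring. -/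
def alg : AISemiringAlg.{u} where
  carrier := SR6
  nonempty := ⟨e1⟩

end SR6

/-- The free commutative semigroup over `X`: nonempty commutative words, that is, nonempty
multisets of letters. The product of two words is the sum of the multisets. -/
def CommWord (X : Type u) : Type u := {w : Multiset X // w ≠ 0}

/-- The nonempty subwords of the words in `W`. -/
def CommWord.Subword {X : Type u} (W : Set (CommWord X)) : Type u :=
  {w : Multiset X // w ≠ 0 ∧ ∃ v ∈ W, w ≤ v.1}

/-- The carrier of `S_c(W)`: the nonempty subwords of words in `W` and a new symbol `0`. -/
inductive Sc {X : Type u} (W : Set (CommWord X)) : Type u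
  | word (w : CommWord.Subword W)
  | zero

namespace Sc

variable {X : Type u} {W : Set (CommWord X)}

open Classical in
/-- `u + u = u`, and any other sum is `0`. -/
noncomputable def add (x y : Sc W) : Sc W := if x = y then x else zero

open Classical in
/-- The product of `u` and `v` is the word `uv` if that is a subword of a word in `W`,
and `0` otherwise. -/
noncomputable def mul : Sc W → Sc W → Sc W
  | word x, word y =>
    if h : x.1 + y.1 ≠ 0 ∧ ∃ v ∈ W, x.1 + y.1 ≤ v.1 then word ⟨x.1 + y.1, h⟩ else zero
  | _, _ => zero

theorem add_same (x : Sc W) : add x x = x := if_pos rfl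

theorem add_of_ne {x y : Sc W} (h : x ≠ y) : add x y = zero := if_neg h

theorem add_zero (x : Sc W) : add x zero = zero := by
  by_cases h : x = zero
  · rw [h, add_same]
  · exact add_of_ne h

protected theorem add_comm' (x y : Sc W) : add x y = add y x := by
  by_cases h : x = y
  · rw [h]
  · rw [add_of_ne h, add_of_ne (Ne.symm h)]

protected theorem add_assoc' (x y z : Sc W) : add (add x y) z = add x (add y z) := by
  by_cases h : x = y
  · subst h
    rw [add_same]
    by_cases h' : x = z
    · rw [← h', add_same, add_same]
    · rw [add_of_ne h', add_zero]
  · rw [add_of_ne h, Sc.add_comm' zero, add_zero]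
    by_cases h' : y = z
    · rw [← h', add_same, add_of_ne h]
    · rw [add_of_ne h', add_zero]

protected theorem ext' {x y : Sc W} (h : ∀ w, x = word w ↔ y = word w) : x = y := by
  rcases x with a | _
  · exact ((h a).1 rfl).symm
  · rcases y with b | _
    · exact (h b).2 rfl
    · rfl

theorem mul_eq_word_iff (x y : Sc W) (w : CommWord.Subword W) :
    mul x y = word w ↔ ∃ a b, x = word a ∧ y = word b ∧ w.1 = a.1 + b.1 := by
  constructor
  · intro h
    rcases x with a | _
    swap
    · cases h
    rcases y with b | _
    swap
    · cases h
    refine ⟨a, b, rfl, rfl, ?_⟩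
    by_cases hw : a.1 + b.1 ≠ 0 ∧ ∃ v ∈ W, a.1 + b.1 ≤ v.1
    · have h' := (dif_pos hw).symm.trans h
      exact (congrArg Subtype.val (Sc.word.inj h')).symm
    · have h' := (dif_neg hw).symm.trans h
      cases h'
  · rintro ⟨a, b, rfl, rfl, h⟩
    have hw : a.1 + b.1 ≠ 0 ∧ ∃ v ∈ W, a.1 + b.1 ≤ v.1 := by
      rw [← h]
      exact w.2
    exact (dif_pos hw).trans (congrArg word (Subtype.ext h.symm))

protected theorem mul_comm' (x y : Sc W) : mul x y = mul y x := by
  refine Sc.ext' fun w => (mul_eq_word_iff x y w).trans ((mul_eq_word_iff y x w).trans ?_).symm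
  constructor
  · rintro ⟨a, b, h1, h2, h⟩
    exact ⟨b, a, h2, h1, h.trans (add_comm _ _)⟩
  · rintro ⟨a, b, h1, h2, h⟩
    exact ⟨b, a, h2, h1, h.trans (add_comm _ _)⟩

theorem mul_mul_eq_word_iff (x y z : Sc W) (w : CommWord.Subword W) :
    mul (mul x y) z = word w ↔
      ∃ a b c, x = word a ∧ y = word b ∧ z = word c ∧ w.1 = a.1 + b.1 + c.1 := by
  rw [mul_eq_word_iff]
  constructor
  · rintro ⟨d, c, hd, hc, h⟩
    obtain ⟨a, b, ha, hb, hab⟩ := (mul_eq_word_iff x y d).1 hd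
    exact ⟨a, b, c, ha, hb, hc, hab ▸ h⟩
  · rintro ⟨a, b, c, ha, hb, hc, h⟩
    obtain ⟨_, v, hv, hle⟩ := w.2
    have hab : a.1 + b.1 ≤ w.1 := h ▸ Multiset.le_add_right _ _
    have ha0 : a.1 + b.1 ≠ 0 := fun h0 => a.2.1 (by
      have h1 := Multiset.le_add_right a.1 b.1
      rw [h0] at h1
      exact Multiset.le_zero.1 h1)
    exact ⟨⟨a.1 + b.1, ha0, v, hv, hab.trans hle⟩, c,
      (mul_eq_word_iff x y _).2 ⟨a, b, ha, hb, rfl⟩, hc, h⟩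

protected theorem mul_assoc' (x y z : Sc W) : mul (mul x y) z = mul x (mul y z) := by
  rw [Sc.mul_comm' x (mul y z)]
  refine Sc.ext' fun w => (mul_mul_eq_word_iff x y z w).trans
    ((mul_mul_eq_word_iff y z x w).trans ?_).symm
  constructor
  · rintro ⟨b, c, a, hb, hc, ha, h⟩
    exact ⟨a, b, c, ha, hb, hc, by rw [h, add_comm, add_assoc]⟩
  · rintro ⟨a, b, c, ha, hb, hc, h⟩
    exact ⟨b, c, a, hb, hc, ha, by rw [h, add_comm, add_assoc, add_comm, add_assoc, add_comm,
      add_assoc, add_comm]⟩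

protected theorem mul_add' (x y z : Sc W) : mul x (add y z) = add (mul x y) (mul x z) := by
  by_cases hyz : y = z
  · rw [hyz, add_same, add_same]
  · rw [add_of_ne hyz]
    have h0 : mul x zero = zero := by cases x <;> rfl
    by_cases h : mul x y = mul x z
    · rw [← h, add_same, h0]
      symm
      rcases hw : mul x y with w | _
      swap
      · rfl
      obtain ⟨a, b, ha, hb, hab⟩ := (mul_eq_word_iff x y w).1 hw
      obtain ⟨a', c, ha', hc, hac⟩ := (mul_eq_word_iff x z w).1 (h ▸ hw)
      obtain rfl : a = a' := Sc.word.inj (ha.symm.trans ha')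
      exact absurd (hb.trans ((congrArg word (Subtype.ext
        (add_left_cancel (hab.symm.trans hac)))).trans hc.symm)) hyz
    · rw [add_of_ne h, h0]

noncomputable instance : AISemiring (Sc W) where
  add := add
  mul := mul
  add_assoc := Sc.add_assoc'
  add_comm := Sc.add_comm'
  mul_assoc := Sc.mul_assoc'
  left_distrib := Sc.mul_add'
  right_distrib := by
    intro x y z
    change mul (add x y) z = add (mul x z) (mul y z)
    rw [Sc.mul_comm' _ z, Sc.mul_add', Sc.mul_comm' z, Sc.mul_comm' z]
  add_self := add_same

/-- `S_c(W)` as an ai-semiring. -/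
noncomputable def alg (W : Set (CommWord X)) : AISemiringAlg.{u} where
  carrier := Sc W
  nonempty := ⟨zero⟩

end Sc

/-- The word `a`, over a countably infinite alphabet. -/
def wordA : CommWord (ULift.{u} ℕ) := ⟨{⟨0⟩}, Multiset.singleton_ne_zero _⟩

/-- The word `ab` with two distinct letters `a`, `b`. -/
def wordAB : CommWord (ULift.{u} ℕ) := ⟨{⟨0⟩, ⟨1⟩}, Multiset.cons_ne_zero⟩

/-- The two-element ai-semiring `S_c(a)`. -/
noncomputable def ScA : AISemiringAlg.{u} := Sc.alg {wordA}

/-- The four-element ai-semiring `S_c(ab)`. -/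
noncomputable def ScAB : AISemiringAlg.{u} := Sc.alg {wordAB}

/-! Under `IsThreeNil o` the value of a term depends only on its one-letter words, on the graph
formed by its two-letter words, and on whether a longer word occurs: the value lies below `c`
exactly when the value of each word does (`eval_below_iff`). Identities thus become statements about
graphs whose edges are the products below a fixed `c ≠ o`. In `SR6` the products equal to 3 form the
path 2–6–5–4; in `S_c(ab)` there is the single edge a–b, and in `S_c(a)` none.

Subvarieties: every member of V(SR₆) satisfies `IsThreeNil` and `TriangleLaw`. If a member violates
`PathLaw`, four of its elements reproduce the path 2–6–5–4, and `SR6` lies in every variety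
containing that member (`sr6_mem`). If `PathLaw` holds, the graphs above are triangle-free and every
path with three edges closes up, so their nontrivial components are complete bipartite. Such graphs
have enough two-colourings (`exists_coloring`) to put the member into V(S_c(ab)). In the same way a
product other than `o` produces `S_c(ab)`, and an element other than `o` produces `S_c(a)`. This
leaves three proper subvarieties, each cut out by an explicit finite list of identities.

No finite basis: an identity of `SR6` can fail in a three-nil algebra only where the two-letter
words form a non-bipartite graph (`eval_below_eval_of_sr6`). In the algebra of a long odd cycle, few
variables miss some vertex, and the rest of the cycle is bipartite; so all identities of `SR6` in
few variables hold there. Yet the law sending odd cycles to `o` holds in `SR6` and fails in that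
algebra. -/

/-! ### The natural order -/

/-- The natural order of an ai-semiring. -/
def Below {S : Type u} [AISemiring S] (x y : S) : Prop := x + y = y

infix:50 " ≼ " => Below

section Order

variable {S : Type u} [AISemiring S]

theorem below_refl (x : S) : x ≼ x := AISemiring.add_self x

theorem below_antisymm {x y : S} (h : x ≼ y) (h' : y ≼ x) : x = y := by
  unfold Below at h h'
  rw [← h, add_comm, h']

theorem add_below_iff {x y c : S} : x + y ≼ c ↔ x ≼ c ∧ y ≼ c := by
  unfold Below
  constructor
  · intro h
    constructor
    · rw [← h, ← add_assoc, ← add_assoc, AISemiring.add_self]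
    · rw [← h, ← add_assoc, add_comm x y, ← add_assoc, AISemiring.add_self]
  · rintro ⟨h, h'⟩
    rw [add_assoc, h', h]

end Order

/-- The common laws of the ai-semirings below: multiplication is commutative, and all squares,
all products of three elements and all sums `x + xy` equal the greatest element `o`. -/
structure IsThreeNil {S : Type u} [AISemiring S] (o : S) : Prop where
  mul_comm : ∀ x y : S, x * y = y * x
  add_top : ∀ x : S, x + o = o
  sq : ∀ x : S, x * x = o
  mul_mul : ∀ x y z : S, x * y * z = o
  add_mul : ∀ x y : S, x + x * y = o

/-- Triangles evaluate to the greatest element. -/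
def TriangleLaw {S : Type u} [AISemiring S] (o : S) : Prop :=
  ∀ x y z : S, x * y + y * z + z * x = o

/-- A path with three edges can be completed to a four-cycle. -/
def PathLaw (S : Type u) [AISemiring S] : Prop :=
  ∀ x y z w : S, x * y + y * z + z * w = x * y + y * z + z * w + x * w

namespace IsThreeNil

variable {S : Type u} [AISemiring S] {o : S}

theorem top_below_iff (h : IsThreeNil o) {c : S} : o ≼ c ↔ c = o := by
  unfold Below
  rw [add_comm, h.add_top]
  exact eq_comm

theorem mul_top (h : IsThreeNil o) (x : S) : x * o = o := by
  rw [h.mul_comm, ← h.sq o, h.mul_mul, h.sq]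

/-- Otherwise `x + x * y = o` would be below `c`. Hence an endpoint of an edge is never itself below
`c`. -/
theorem not_below_of_mul_below (h : IsThreeNil o) {x y c : S} (hc : c ≠ o) (hxy : x * y ≼ c) :
    ¬ x ≼ c := fun hx =>
  hc (h.top_below_iff.1 (h.add_mul x y ▸ add_below_iff.2 ⟨hx, hxy⟩))

end IsThreeNil

/-! ### Terms over an arbitrary set of variables -/

/-- Terms in the two binary operation symbols over the variables `X`. -/
inductive PolyTerm (X : Type*)
  | var : X → PolyTerm X
  | add : PolyTerm X → PolyTerm X → PolyTerm X
  | mul : PolyTerm X → PolyTerm X → PolyTerm X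

namespace PolyTerm

variable {X : Type*} {S : Type u}

/-- The value of a term under an assignment of the variables. -/
def eval [Add S] [Mul S] (v : X → S) : PolyTerm X → S
  | var x => v x
  | add s t => s.eval v + t.eval v
  | mul s t => s.eval v * t.eval v

/-- The one-letter words of a term. -/
def Lin : PolyTerm X → X → Prop
  | var y, x => x = y
  | add s t, x => s.Lin x ∨ t.Lin x
  | mul _ _, _ => False

/-- The two-letter words of a term. -/
def Edge : PolyTerm X → X → X → Prop
  | var _, _, _ => False
  | add s t, x, y => s.Edge x y ∨ t.Edge x y
  | mul s t, x, y => s.Lin x ∧ t.Lin y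

/-- The term has a word of length at least three. -/
def Long : PolyTerm X → Prop
  | var _ => False
  | add s t => s.Long ∨ t.Long
  | mul s t => (s.Long ∨ ∃ x y, s.Edge x y) ∨ (t.Long ∨ ∃ x y, t.Edge x y)

/-- The term has a word of length at least two. -/
def Nonlin (t : PolyTerm X) : Prop := t.Long ∨ ∃ x y, t.Edge x y

theorem nonlin_add {s t : PolyTerm X} : (add s t).Nonlin ↔ s.Nonlin ∨ t.Nonlin := by
  simp only [Nonlin, Long, Edge, exists_or]
  exact or_or_or_comm

theorem exists_lin_or_nonlin (t : PolyTerm X) : (∃ x, t.Lin x) ∨ t.Nonlin := by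
  induction t with
  | var x => exact Or.inl ⟨x, rfl⟩
  | add s t hs ht =>
    rw [nonlin_add]
    simp only [Lin, exists_or]
    tauto
  | mul s t hs ht =>
    right
    rcases hs with ⟨x, hx⟩ | hs
    · rcases ht with ⟨y, hy⟩ | ht
      · exact Or.inr ⟨x, y, hx, hy⟩
      · exact Or.inl (Or.inr ht)
    · exact Or.inl (Or.inl hs)

theorem nonlin_mul (s t : PolyTerm X) : (mul s t).Nonlin := by
  simpa [Lin] using exists_lin_or_nonlin (mul s t)

variable [AISemiring S] {o : S}

/-- A word of length at least two, multiplied by `u`, is a product of three elements and so equals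
`o`; only the letters of `t` give anything else. -/
theorem eval_mul_below_iff (h : IsThreeNil o) (v : X → S) (t : PolyTerm X) (u c : S) :
    t.eval v * u ≼ c ↔ (∀ x, t.Lin x → v x * u ≼ c) ∧ (t.Nonlin → o ≼ c) := by
  induction t with
  | var x => simp [eval, Lin, Nonlin, Long, Edge]
  | add s t hs ht =>
    rw [eval, add_mul, add_below_iff, hs, ht, nonlin_add]
    simp only [Lin, or_imp, forall_and]
    tauto
  | mul s t hs ht =>
    rw [eval, h.mul_mul]
    simp [Lin, nonlin_mul]

/-- A term lies below `c` if and only if all its words do. -/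
theorem eval_below_iff (h : IsThreeNil o) (v : X → S) (t : PolyTerm X) (c : S) :
    t.eval v ≼ c ↔ (∀ x, t.Lin x → v x ≼ c) ∧ (∀ x y, t.Edge x y → v x * v y ≼ c) ∧
      (t.Long → o ≼ c) := by
  induction t with
  | var x => simp [eval, Lin, Long, Edge]
  | add s t hs ht =>
    rw [eval, add_below_iff, hs, ht]
    simp only [Lin, Edge, Long, or_imp, forall_and]
    tauto
  | mul s t hs ht =>
    have key : ∀ x, v x * t.eval v ≼ c ↔ (∀ y, t.Lin y → v x * v y ≼ c) ∧ (t.Nonlin → o ≼ c) := by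
      intro x
      rw [h.mul_comm, eval_mul_below_iff h]
      simp only [h.mul_comm (v x)]
    rw [eval, eval_mul_below_iff h]
    simp only [key]
    -- A word of length at least two in `t` gives `o` only after multiplication by some word of `s`,
    -- so `s` must be known to have one.
    have hs' := s.exists_lin_or_nonlin
    constructor
    · rintro ⟨h1, h2⟩
      refine ⟨fun _ => False.elim, fun x y hxy => (h1 x hxy.1).1 y hxy.2, ?_⟩
      rintro (h3 | h3)
      · exact h2 h3
      · rcases hs' with ⟨x, hx⟩ | hs'
        · exact (h1 x hx).2 h3
        · exact h2 hs'
    · rintro ⟨-, h1, h2⟩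
      exact ⟨fun x hx => ⟨fun y hy => h1 x y ⟨hx, hy⟩, fun h3 => h2 (Or.inr h3)⟩,
        fun h3 => h2 (Or.inl h3)⟩

/-- Comparison of two terms, the first of which is a sum of variables. -/
theorem eval_below_eval_of_not_nonlin {A : Type u} [AISemiring A] {o' : A} (hA : IsThreeNil o')
    (h : IsThreeNil o) {q : S} (hq : q ≠ o) {s t : PolyTerm X}
    (hst : ∀ v : X → S, s.eval v = t.eval v) (hs : ¬ s.Nonlin) (φ : X → A) :
    t.eval φ ≼ s.eval φ := by
  classical
  have hoq : ¬ o ≼ q := fun h' => hq (h.top_below_iff.1 h')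
  -- All products are `o` under this assignment, so `t` can lie below `q` only if it is a sum of
  -- letters of `s`.
  let v : X → S := fun x => if s.Lin x then q else o
  have hv : ∀ x y, v x * v y = o := by
    intro x y
    simp only [v]
    split_ifs
    · exact h.sq q
    · exact h.mul_top q
    · rw [h.mul_comm, h.mul_top]
    · exact h.sq o
  have hvs : s.eval v ≼ q := by
    rw [eval_below_iff h]
    refine ⟨fun x hx => ?_, fun x y hxy => (hs (Or.inr ⟨x, y, hxy⟩)).elim,
      fun hl => (hs (Or.inl hl)).elim⟩
    simp only [v, if_pos hx]
    exact below_refl q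
  rw [hst, eval_below_iff h] at hvs
  have hφ := (eval_below_iff hA φ s _).1 (below_refl _)
  rw [eval_below_iff hA]
  refine ⟨fun x hx => hφ.1 x ?_, fun x y hxy => ?_, fun hl => (hoq (hvs.2.2 hl)).elim⟩
  · by_contra hx'
    have := hvs.1 x hx
    simp only [v, if_neg hx'] at this
    exact hoq this
  · have := hvs.2.1 x y hxy
    rw [hv] at this
    exact (hoq this).elim

theorem exists_bound (t : PolyTerm ℕ) :
    ∃ N, (∀ x, t.Lin x → x < N) ∧ ∀ x y, t.Edge x y → x < N ∧ y < N := by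
  induction t with
  | var x => exact ⟨x + 1, fun y hy => by cases hy; omega, fun _ _ => False.elim⟩
  | add s t hs ht =>
    obtain ⟨M, h1, h2⟩ := hs
    obtain ⟨N, h3, h4⟩ := ht
    refine ⟨max M N, ?_, ?_⟩
    · rintro x (hx | hx)
      · exact lt_max_of_lt_left (h1 x hx)
      · exact lt_max_of_lt_right (h3 x hx)
    · rintro x y (hx | hx)
      · exact ⟨lt_max_of_lt_left (h2 x y hx).1, lt_max_of_lt_left (h2 x y hx).2⟩
      · exact ⟨lt_max_of_lt_right (h4 x y hx).1, lt_max_of_lt_right (h4 x y hx).2⟩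
  | mul s t hs ht =>
    obtain ⟨M, h1, h2⟩ := hs
    obtain ⟨N, h3, h4⟩ := ht
    exact ⟨max M N, fun _ => False.elim, fun x y hxy =>
      ⟨lt_max_of_lt_left (h1 x hxy.1), lt_max_of_lt_right (h3 y hxy.2)⟩⟩

end PolyTerm

/-- A term over the standard variables as a term over `ℕ`. -/
def AITerm.toPoly : AITerm → PolyTerm ℕ
  | .var n => .var n
  | .add s t => .add s.toPoly t.toPoly
  | .mul s t => .mul s.toPoly t.toPoly

theorem AITerm.eval_toPoly {S : Type u} [Add S] [Mul S] (v : ℕ → S) (t : AITerm) :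
    t.toPoly.eval v = t.eval v := by
  induction t with
  | var n => rfl
  | add s t hs ht => simp only [toPoly, PolyTerm.eval, AITerm.eval, hs, ht]
  | mul s t hs ht => simp only [toPoly, PolyTerm.eval, AITerm.eval, hs, ht]

/-! ### Varieties -/

namespace AIVariety

theorem generatedBy_le_iff {A : AISemiringAlg.{u}} {V : AIVariety.{u}} :
    generatedBy A ≤ V ↔ A ∈ V.carrier :=
  ⟨fun h => h fun _ hA => hA, fun h _ hB => hB V h⟩

theorem mem_generatedBy (A : AISemiringAlg.{u}) : A ∈ (generatedBy A).carrier := fun _ hA => hA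

theorem trivial_le (V : AIVariety.{u}) : trivial ≤ V := by
  intro B (hB : Subsingleton B)
  obtain ⟨b⟩ := B.nonempty
  -- The product of the empty family is a one-element member of every variety.
  refine V.image_mem (A := AISemiringAlg.prod (ι := PEmpty) PEmpty.elim) (fun _ => b)
    ⟨fun _ _ => Subsingleton.elim _ _, fun _ _ => Subsingleton.elim _ _⟩
    (fun x => ⟨fun i => i.elim, Subsingleton.elim _ _⟩) (V.prod_mem _ fun i => i.elim)

/-- A relation that is functional, onto, and compatible with the operations exhibits its second
side as a homomorphic image of a subalgebra of the first. -/
theorem mem_of_rel (V : AIVariety.{u}) {A S : AISemiringAlg.{u}} (R : A → S → Prop)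
    (hadd : ∀ {x y s t}, R x s → R y t → R (x + y) (s + t))
    (hmul : ∀ {x y s t}, R x s → R y t → R (x * y) (s * t))
    (hfun : ∀ {x s t}, R x s → R x t → s = t) (hsurj : ∀ s, ∃ x, R x s)
    (hA : A ∈ V.carrier) : S ∈ V.carrier := by
  -- The domain of `R` is a subalgebra, and sending each `x` to its unique partner is a homomorphism
  -- onto `S`.
  let T := {x : A // ∃ s, R x s}
  let iT : AISemiring T :=
    { add := fun x y => ⟨x.1 + y.1, x.2.choose + y.2.choose,
        hadd x.2.choose_spec y.2.choose_spec⟩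
      mul := fun x y => ⟨x.1 * y.1, x.2.choose * y.2.choose,
        hmul x.2.choose_spec y.2.choose_spec⟩
      add_assoc := fun x y z => Subtype.ext (add_assoc x.1 y.1 z.1)
      add_comm := fun x y => Subtype.ext (add_comm x.1 y.1)
      mul_assoc := fun x y z => Subtype.ext (mul_assoc x.1 y.1 z.1)
      left_distrib := fun x y z => Subtype.ext (mul_add x.1 y.1 z.1)
      right_distrib := fun x y z => Subtype.ext (add_mul x.1 y.1 z.1)
      add_self := fun x => Subtype.ext (AISemiring.add_self x.1) }
  have hT : Nonempty T := by
    obtain ⟨s⟩ := S.nonempty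
    obtain ⟨x, hx⟩ := hsurj s
    exact ⟨⟨x, s, hx⟩⟩
  let B : AISemiringAlg.{u} := { carrier := T }
  have hB : B ∈ V.carrier := V.sub_mem (A := A) (B := B) (fun x : T => x.1)
    ⟨fun _ _ => rfl, fun _ _ => rfl⟩ Subtype.val_injective hA
  refine V.image_mem (A := B) (fun x : T => x.2.choose) ⟨fun x y => ?_, fun x y => ?_⟩
    (fun s => ?_) hB
  · exact hfun (x + y : T).2.choose_spec (hadd x.2.choose_spec y.2.choose_spec)
  · exact hfun (x * y : T).2.choose_spec (hmul x.2.choose_spec y.2.choose_spec)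
  · obtain ⟨x, hx⟩ := hsurj s
    exact ⟨⟨x, s, hx⟩, hfun (Exists.choose_spec _) hx⟩

/-- An algebra that satisfies all identities of `S` lies in the variety generated by `S`. -/
theorem mem_generatedBy_of_eval_eq {A S : AISemiringAlg.{u}}
    (h : ∀ s t : PolyTerm A, (∀ v : A → S, s.eval v = t.eval v) → s.eval id = t.eval id) :
    A ∈ (generatedBy S).carrier := by
  -- The term functions inside this power form the relatively free algebra on the set `A`. Using the
  -- elements of `A` as variables makes the argument work in every cardinality.
  let P := AISemiringAlg.prod (ι := A → S) fun _ => S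
  refine mem_of_rel _ (A := P)
    (fun x a => ∃ t : PolyTerm A, (∀ v : A → S, x v = t.eval v) ∧ a = t.eval id) ?_ ?_ ?_ ?_
    ((generatedBy S).prod_mem _ fun _ => mem_generatedBy S)
  · rintro x y a b ⟨s, hs, rfl⟩ ⟨t, ht, rfl⟩
    exact ⟨.add s t, fun v => congrArg₂ (· + ·) (hs v) (ht v), rfl⟩
  · rintro x y a b ⟨s, hs, rfl⟩ ⟨t, ht, rfl⟩
    exact ⟨.mul s t, fun v => congrArg₂ (· * ·) (hs v) (ht v), rfl⟩
  · rintro x a b ⟨s, hs, rfl⟩ ⟨t, ht, rfl⟩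
    exact h s t fun v => (hs v).symm.trans (ht v)
  · exact fun a => ⟨fun v => v a, .var a, fun _ => rfl, rfl⟩

/-- If `S` is generated by `ψ` and its elements are separated by the conditions `a ≼ q` and
`a * ψ x ≼ q`, and if the same conditions with `φ` and `p` match on generators in `A`, then `S`
lies in every variety that contains `A`. -/
theorem mem_of_separation (V : AIVariety.{u}) {A S : AISemiringAlg.{u}} {o : A} {o' : S}
    (hA : IsThreeNil o) (hS : IsThreeNil o') {X : Type} (φ : X → A) (ψ : X → S) (p : A) (q : S)
    (hp : p ≠ o) (hq : q ≠ o') (hlin : ∀ x, φ x ≼ p ↔ ψ x ≼ q)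
    (hedge : ∀ x y, φ x * φ y ≼ p ↔ ψ x * ψ y ≼ q)
    (hsep : ∀ a b : S, (a ≼ q ↔ b ≼ q) → (∀ x, a * ψ x ≼ q ↔ b * ψ x ≼ q) → a = b)
    (hgen : ∀ a : S, ∃ t : PolyTerm X, t.eval ψ = a) (hV : A ∈ V.carrier) : S ∈ V.carrier := by
  have key : ∀ t : PolyTerm X, t.eval φ ≼ p ↔ t.eval ψ ≼ q := by
    intro t
    rw [PolyTerm.eval_below_iff hA, PolyTerm.eval_below_iff hS, hA.top_below_iff,
      hS.top_below_iff]
    simp only [hlin, hedge, hp, hq]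
  -- The value under `φ` determines the one under `ψ`: by `key`, all the tests that separate points
  -- of `S` can be carried out in `A`, with `p` in place of `q`.
  refine V.mem_of_rel (fun x s => ∃ t : PolyTerm X, x = t.eval φ ∧ s = t.eval ψ) ?_ ?_ ?_ ?_ hV
  · rintro _ _ _ _ ⟨s, rfl, rfl⟩ ⟨t, rfl, rfl⟩
    exact ⟨.add s t, rfl, rfl⟩
  · rintro _ _ _ _ ⟨s, rfl, rfl⟩ ⟨t, rfl, rfl⟩
    exact ⟨.mul s t, rfl, rfl⟩
  · rintro _ _ _ ⟨s, h, rfl⟩ ⟨t, rfl, rfl⟩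
    refine hsep _ _ ?_ fun x => ?_
    · rw [← key, ← key, h]
    · have h1 := key (.mul s (.var x))
      have h2 := key (.mul t (.var x))
      simp only [PolyTerm.eval] at h1 h2
      rw [← h1, ← h2, h]
  · intro a
    obtain ⟨t, rfl⟩ := hgen a
    exact ⟨t.eval φ, t, rfl, rfl⟩

/-- The variety of all models of a set of identities. -/
def models (E : Set (AITerm × AITerm)) : AIVariety.{u} where
  carrier := {A | ∀ p ∈ E, SatisfiesIdentity A p}
  sub_mem := by
    intro A B f hf hi hA p hp v
    have key : ∀ t : AITerm, f (t.eval v) = t.eval (f ∘ v) := by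
      intro t
      induction t with
      | var n => rfl
      | add s t hs ht => simp only [AITerm.eval, hf.1, hs, ht]
      | mul s t hs ht => simp only [AITerm.eval, hf.2, hs, ht]
    exact hi (by rw [key, key, hA p hp])
  image_mem := by
    intro A B f hf hs hA p hp v
    obtain ⟨w, rfl⟩ : ∃ w : ℕ → A, f ∘ w = v :=
      ⟨fun n => (hs (v n)).choose, funext fun n => (hs (v n)).choose_spec⟩
    have key : ∀ t : AITerm, f (t.eval w) = t.eval (f ∘ w) := by
      intro t
      induction t with
      | var n => rfl
      | add s t hs ht => simp only [AITerm.eval, hf.1, hs, ht]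
      | mul s t hs ht => simp only [AITerm.eval, hf.2, hs, ht]
    rw [← key, ← key, hA p hp]
  prod_mem := by
    intro ι A hA p hp v
    have key : ∀ (t : AITerm) (i : ι), (t.eval v : ∀ i, A i) i = t.eval fun n => v n i := by
      intro t i
      induction t with
      | var n => rfl
      | add s t hs ht => exact congrArg₂ (· + ·) hs ht
      | mul s t hs ht => exact congrArg₂ (· * ·) hs ht
    exact funext fun i => (key p.1 i).trans ((hA i p hp _).trans (key p.2 i).symm)

theorem isFinitelyBased_models {E : Set (AITerm × AITerm)} (hE : E.Finite) :
    (models.{u} E).IsFinitelyBased := ⟨E, hE, fun _ => Iff.rfl⟩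

end AIVariety

/-! ### Identities -/

/-- The assignment that starts with the four given values. -/
def assign {S : Type u} (x y z w : S) : ℕ → S
  | 0 => x
  | 1 => y
  | 2 => z
  | _ => w

namespace AITerm

/-- The identities that express `IsThreeNil` and `TriangleLaw`. -/
def baseIdentities : Set (AITerm × AITerm) :=
  {(mul (var 0) (var 1), mul (var 1) (var 0)),
   (add (var 1) (mul (var 0) (var 0)), mul (var 0) (var 0)),
   (mul (var 0) (var 0), mul (var 1) (var 1)),
   (mul (mul (var 0) (var 1)) (var 2), mul (var 0) (var 0)),
   (add (var 0) (mul (var 0) (var 1)), mul (var 0) (var 0)),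
   (add (add (mul (var 0) (var 1)) (mul (var 1) (var 2))) (mul (var 2) (var 0)),
    mul (var 0) (var 0))}

/-- The identity that expresses `PathLaw`. -/
def pathIdentity : AITerm × AITerm :=
  (add (add (mul (var 0) (var 1)) (mul (var 1) (var 2))) (mul (var 2) (var 3)),
   add (add (add (mul (var 0) (var 1)) (mul (var 1) (var 2))) (mul (var 2) (var 3)))
    (mul (var 0) (var 3)))

/-- The identity `xy ≈ xx`. -/
def nullIdentity : AITerm × AITerm := (mul (var 0) (var 1), mul (var 0) (var 0))

theorem baseIdentities_finite : baseIdentities.Finite := by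
  unfold baseIdentities
  exact Set.toFinite _

/-- There is no constant symbol for `o`, so the identities write it as a square; one of them makes
all squares equal. -/
theorem satisfies_baseIdentities_iff (A : AISemiringAlg.{u}) :
    (∀ p ∈ baseIdentities, SatisfiesIdentity A p) ↔
      ∃ o : A, IsThreeNil o ∧ TriangleLaw o := by
  constructor
  · intro h
    obtain ⟨a⟩ := A.nonempty
    simp only [baseIdentities, Set.mem_insert_iff, Set.mem_singleton_iff, forall_eq_or_imp,
      forall_eq] at h
    obtain ⟨h1, h2, h3, h4, h5, h6⟩ := h
    have hsq : ∀ x : A, x * x = a * a := fun x => h3 (assign x a a a)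
    refine ⟨a * a, ⟨fun x y => h1 (assign x y a a), fun x => h2 (assign a x a a), hsq,
      fun x y z => ?_, fun x y => ?_⟩, fun x y z => ?_⟩
    · exact (h4 (assign x y z a)).trans (hsq x)
    · exact (h5 (assign x y a a)).trans (hsq x)
    · exact (h6 (assign x y z a)).trans (hsq x)
  · rintro ⟨o, h, ht⟩
    simp only [baseIdentities, Set.mem_insert_iff, Set.mem_singleton_iff, forall_eq_or_imp,
      forall_eq]
    refine ⟨fun v => h.mul_comm _ _, fun v => ?_, fun v => ?_, fun v => ?_, fun v => ?_,
      fun v => ?_⟩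
    · simp only [eval, h.sq, h.add_top]
    · simp only [eval, h.sq]
    · simp only [eval, h.sq, h.mul_mul]
    · simp only [eval, h.sq, h.add_mul]
    · simp only [eval, h.sq]
      exact ht _ _ _

theorem satisfies_pathIdentity_iff (A : AISemiringAlg.{u}) :
    SatisfiesIdentity A pathIdentity ↔ PathLaw A :=
  ⟨fun h x y z w => h (assign x y z w), fun h _ => h _ _ _ _⟩

theorem satisfies_nullIdentity_iff {A : AISemiringAlg.{u}} {o : A} (h : IsThreeNil o) :
    SatisfiesIdentity A nullIdentity ↔ ∀ x y : A, x * y = o :=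
  ⟨fun h' x y => (h' (assign x y x x)).trans (h.sq x), fun h' _ => (h' _ _).trans (h' _ _).symm⟩

end AITerm

/-! ### The algebras -/

namespace SR6

instance : DecidableEq SR6.{u} := fun x y => by
  cases x <;> cases y <;> first | exact isTrue rfl | exact isFalse nofun

instance : Fintype SR6.{u} := ⟨{e1, e2, e3, e4, e5, e6}, fun x => by cases x <;> decide⟩

instance (x y : SR6.{u}) : Decidable (x ≼ y) := inferInstanceAs (Decidable (x + y = y))

theorem isThreeNil : IsThreeNil (e1 : SR6.{u}) :=
  ⟨by decide, by decide, by decide, by decide, by decide⟩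

theorem triangleLaw : TriangleLaw (e1 : SR6.{u}) := by unfold TriangleLaw; decide

/-- The products along the path 2, 6, 5, 4 are all 3, but its endpoints have product 1. -/
theorem not_pathLaw : ¬ PathLaw SR6.{u} := fun h => absurd (h e2 e6 e5 e4) (by decide)

end SR6

theorem Sc.mul_word_of_not_le {X : Type u} {v : CommWord X} {x y : CommWord.Subword {v}}
    (h : ¬ x.1 + y.1 ≤ v.1) : Sc.mul (.word x) (.word y) = .zero :=
  dif_neg (by rintro ⟨-, _, rfl, h'⟩; exact h h')

/-- The multiplication and addition tables of `S_c(ab)`. -/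
inductive FlatAB : Type u
  | a | b | ab | z

namespace FlatAB

instance : DecidableEq FlatAB.{u} := fun x y => by
  cases x <;> cases y <;> first | exact isTrue rfl | exact isFalse nofun

instance : Fintype FlatAB.{u} := ⟨{a, b, ab, z}, fun x => by cases x <;> decide⟩

/-- Addition table. -/
def add : FlatAB.{u} → FlatAB.{u} → FlatAB.{u}
  | a, a => a
  | b, b => b
  | ab, ab => ab
  | _, _ => z

/-- Multiplication table. -/
def mul : FlatAB.{u} → FlatAB.{u} → FlatAB.{u}
  | a, b => ab
  | b, a => ab
  | _, _ => z

instance : AISemiring FlatAB.{u} where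
  add := add
  mul := mul
  add_assoc := by rintro (_ | _) (_ | _) (_ | _) <;> rfl
  add_comm := by rintro (_ | _) (_ | _) <;> rfl
  mul_assoc := by rintro (_ | _) (_ | _) (_ | _) <;> rfl
  left_distrib := by rintro (_ | _) (_ | _) (_ | _) <;> rfl
  right_distrib := by rintro (_ | _) (_ | _) (_ | _) <;> rfl
  add_self := by rintro (_ | _) <;> rfl

instance (x y : FlatAB.{u}) : Decidable (x ≼ y) := inferInstanceAs (Decidable (x + y = y))

/-- The bundled algebra. -/
def alg : AISemiringAlg.{u} where
  carrier := FlatAB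
  nonempty := ⟨z⟩

theorem isThreeNil : IsThreeNil (z : FlatAB.{u}) :=
  ⟨by decide, by decide, by decide, by decide, by decide⟩

theorem triangleLaw : TriangleLaw (z : FlatAB.{u}) := by unfold TriangleLaw; decide

theorem pathLaw : PathLaw FlatAB.{u} := by unfold PathLaw; decide

/-- The elements of `S_c(ab)`. -/
def toSc : FlatAB.{u} → Sc {wordAB.{u}}
  | a => .word ⟨{⟨0⟩}, Multiset.singleton_ne_zero _, wordAB, rfl, by unfold wordAB; decide⟩
  | b => .word ⟨{⟨1⟩}, Multiset.singleton_ne_zero _, wordAB, rfl, by unfold wordAB; decide⟩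
  | ab => .word ⟨{⟨0⟩, ⟨1⟩}, Multiset.cons_ne_zero, wordAB, rfl, le_rfl⟩
  | z => .zero

theorem toSc_injective : Function.Injective toSc.{u} := by
  intro x y h
  cases x <;> cases y <;> first
    | rfl
    | cases h
    | exact absurd (congrArg Subtype.val (Sc.word.inj h)) (by decide)

theorem toSc_surjective : Function.Surjective toSc.{u} := by
  rintro (⟨w, h0, v, rfl, hw⟩ | _)
  · have h : w ∈ Multiset.powerset ({⟨0⟩, ⟨1⟩} : Multiset (ULift.{u} ℕ)) :=
      Multiset.mem_powerset.2 hw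
    have h' : w = 0 ∨ w = {⟨0⟩} ∨ w = {⟨1⟩} ∨ w = {⟨0⟩, ⟨1⟩} := by
      simp only [Multiset.insert_eq_cons, ← Multiset.cons_zero, Multiset.powerset_cons,
        Multiset.powerset_zero, Multiset.mem_add, Multiset.mem_map, Multiset.mem_cons,
        Multiset.notMem_zero, or_false, exists_eq_or_imp, exists_eq_left, eq_comm] at h ⊢
      simp at h ⊢
      tauto
    rcases h' with rfl | rfl | rfl | rfl
    · exact absurd rfl h0
    · exact ⟨a, rfl⟩
    · exact ⟨b, rfl⟩
    · exact ⟨ab, rfl⟩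
  · exact ⟨z, rfl⟩

theorem isSemiringHom_toSc : IsSemiringHom toSc.{u} := by
  constructor
  · intro x y
    change _ = Sc.add _ _
    by_cases h : x = y
    · subst h
      rw [Sc.add_same, AISemiring.add_self]
    · rw [Sc.add_of_ne fun h' => h (toSc_injective h')]
      cases x <;> cases y <;> first | rfl | exact absurd rfl h
  · intro x y
    change _ = Sc.mul _ _
    cases x <;> cases y <;> first
      | rfl
      | exact ((Sc.mul_eq_word_iff _ _ _).2 ⟨_, _, rfl, rfl, by decide⟩).symm
      | exact (Sc.mul_word_of_not_le (by unfold wordAB; decide)).symm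

theorem generatedBy_ScAB : AIVariety.generatedBy ScAB.{u} = AIVariety.generatedBy alg :=
  le_antisymm
    (AIVariety.generatedBy_le_iff.2 (AIVariety.image_mem _ (A := alg) (B := ScAB) toSc
      isSemiringHom_toSc toSc_surjective (AIVariety.mem_generatedBy _)))
    (AIVariety.generatedBy_le_iff.2 (AIVariety.sub_mem _ (B := alg) (A := ScAB) toSc
      isSemiringHom_toSc toSc_injective (AIVariety.mem_generatedBy _)))

end FlatAB

/-- The multiplication and addition tables of `S_c(a)`. -/
inductive FlatA : Type u
  | a | z

namespace FlatA

instance : DecidableEq FlatA.{u} := fun x y => by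
  cases x <;> cases y <;> first | exact isTrue rfl | exact isFalse nofun

instance : Fintype FlatA.{u} := ⟨{a, z}, fun x => by cases x <;> decide⟩

/-- Addition table. -/
def add : FlatA.{u} → FlatA.{u} → FlatA.{u}
  | a, a => a
  | _, _ => z

instance : AISemiring FlatA.{u} where
  add := add
  mul := fun _ _ => z
  add_assoc := by rintro (_ | _) (_ | _) (_ | _) <;> rfl
  add_comm := by rintro (_ | _) (_ | _) <;> rfl
  mul_assoc := by rintro (_ | _) (_ | _) (_ | _) <;> rfl
  left_distrib := by rintro (_ | _) (_ | _) (_ | _) <;> rfl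
  right_distrib := by rintro (_ | _) (_ | _) (_ | _) <;> rfl
  add_self := by rintro (_ | _) <;> rfl

instance (x y : FlatA.{u}) : Decidable (x ≼ y) := inferInstanceAs (Decidable (x + y = y))

/-- The bundled algebra. -/
def alg : AISemiringAlg.{u} where
  carrier := FlatA
  nonempty := ⟨z⟩

theorem isThreeNil : IsThreeNil (z : FlatA.{u}) :=
  ⟨by decide, by decide, by decide, by decide, by decide⟩

/-- The elements of `S_c(a)`. -/
def toSc : FlatA.{u} → Sc {wordA.{u}}
  | a => .word ⟨{⟨0⟩}, Multiset.singleton_ne_zero _, wordA, rfl, le_rfl⟩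
  | z => .zero

theorem toSc_injective : Function.Injective toSc.{u} := by
  intro x y h
  cases x <;> cases y <;> first | rfl | cases h

theorem toSc_surjective : Function.Surjective toSc.{u} := by
  rintro (⟨w, h0, v, rfl, hw⟩ | _)
  · rcases Multiset.le_singleton.1 hw with rfl | rfl
    · exact absurd rfl h0
    · exact ⟨a, rfl⟩
  · exact ⟨z, rfl⟩

theorem isSemiringHom_toSc : IsSemiringHom toSc.{u} := by
  constructor
  · intro x y
    change _ = Sc.add _ _
    by_cases h : x = y
    · subst h
      rw [Sc.add_same, AISemiring.add_self]
    · rw [Sc.add_of_ne fun h' => h (toSc_injective h')]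
      cases x <;> cases y <;> first | rfl | exact absurd rfl h
  · intro x y
    change _ = Sc.mul _ _
    cases x <;> cases y <;> first
      | rfl
      | exact (Sc.mul_word_of_not_le (by unfold wordA; decide)).symm

theorem generatedBy_ScA : AIVariety.generatedBy ScA.{u} = AIVariety.generatedBy alg :=
  le_antisymm
    (AIVariety.generatedBy_le_iff.2 (AIVariety.image_mem _ (A := alg) (B := ScA) toSc
      isSemiringHom_toSc toSc_surjective (AIVariety.mem_generatedBy _)))
    (AIVariety.generatedBy_le_iff.2 (AIVariety.sub_mem _ (B := alg) (A := ScA) toSc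
      isSemiringHom_toSc toSc_injective (AIVariety.mem_generatedBy _)))

end FlatA

/-! ### Membership of the three algebras -/

namespace AIVariety

variable {V : AIVariety.{u}} {A : AISemiringAlg.{u}} {o : A}

/-- Test against `p` itself: the generator passes, and its square, being `o`, fails, just as for `a`
in `S_c(a)`. -/
theorem flatA_mem (h : IsThreeNil o) {p : A} (hp : p ≠ o) (hV : A ∈ V.carrier) :
    FlatA.alg ∈ V.carrier := by
  refine V.mem_of_separation (S := FlatA.alg) h FlatA.isThreeNil (X := Unit) (fun _ => p)
    (fun _ => FlatA.a) p FlatA.a hp nofun (fun _ => iff_of_true (below_refl p) (below_refl _))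
    (fun _ _ => iff_of_false ?_ ?_) ?_ ?_ hV
  · rwa [h.sq, h.top_below_iff]
  · exact nofun
  · rintro (_ | _) (_ | _) h1 -
    · rfl
    · exact absurd (h1.1 rfl) nofun
    · exact absurd (h1.2 rfl) nofun
    · rfl
  · rintro (_ | _)
    · exact ⟨.var (), rfl⟩
    · exact ⟨.mul (.var ()) (.var ()), rfl⟩

/-- Test against `x * y`: neither letter is below it, squares are `o`, and only the mixed products
pass. This is the pattern of `a`, `b` tested against `ab`. -/
theorem flatAB_mem (h : IsThreeNil o) {x y : A} (hp : x * y ≠ o) (hV : A ∈ V.carrier) :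
    FlatAB.alg ∈ V.carrier := by
  have hsep : ∀ s t : FlatAB.{u}, (s ≼ .ab ↔ t ≼ .ab) →
      (∀ x : Bool, s * cond x .a .b ≼ .ab ↔ t * cond x .a .b ≼ .ab) → s = t := by decide
  have hx := h.not_below_of_mul_below hp (below_refl (x * y))
  have hy : ¬ y ≼ x * y := h.not_below_of_mul_below hp (by rw [h.mul_comm]; exact below_refl _)
  have ho : ¬ o ≼ x * y := by rwa [h.top_below_iff]
  refine V.mem_of_separation (S := FlatAB.alg) h FlatAB.isThreeNil (X := Bool)
    (fun i => cond i x y) (fun i => cond i .a .b) (x * y) FlatAB.ab hp nofun ?_ ?_ hsep ?_ hV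
  · rintro (_ | _)
    · exact iff_of_false hy nofun
    · exact iff_of_false hx nofun
  · rintro (_ | _) (_ | _)
    · exact iff_of_false (by simpa only [cond, h.sq] using ho) nofun
    · exact iff_of_true (by rw [h.mul_comm]; exact below_refl _) rfl
    · exact iff_of_true (below_refl _) rfl
    · exact iff_of_false (by simpa only [cond, h.sq] using ho) nofun
  · rintro (_ | _ | _ | _)
    · exact ⟨.var true, rfl⟩
    · exact ⟨.var false, rfl⟩
    · exact ⟨.mul (.var true) (.var false), rfl⟩
    · exact ⟨.mul (.var true) (.var true), rfl⟩

/-- Take `p = xy + yz + zw` from a failure of the path law. Then `xw` is not below `p`, the triangle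
law excludes `xz` and `yw`, and squares are excluded as well. So the products below `p` form exactly
the path x–y–z–w, which matches 2–6–5–4. -/
theorem sr6_mem (h : IsThreeNil o) (ht : TriangleLaw o) (hpath : ¬ PathLaw A)
    (hV : A ∈ V.carrier) : SR6.alg ∈ V.carrier := by
  unfold PathLaw at hpath
  push Not at hpath
  obtain ⟨x, y, z, w, hne⟩ := hpath
  obtain ⟨p, hp⟩ : ∃ p, p = x * y + y * z + z * w := ⟨_, rfl⟩
  rw [← hp] at hne
  have hpo : p ≠ o := by
    rintro rfl
    exact hne (by rw [add_comm, h.add_top])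
  have hso : ∀ t : A, ¬ t * t ≼ p := fun t => by rwa [h.sq, h.top_below_iff]
  obtain ⟨⟨hxy, hyz⟩, hzw⟩ : (x * y ≼ p ∧ y * z ≼ p) ∧ z * w ≼ p := by
    rw [← add_below_iff, ← add_below_iff, ← hp]
    exact below_refl p
  have hxw : ¬ x * w ≼ p := fun h' => hne (by rw [add_comm]; exact h'.symm)
  have htri : ∀ {r s t : A}, r * s ≼ p → s * t ≼ p → ¬ r * t ≼ p := fun {r s t} h1 h2 h3 =>
    hpo (h.top_below_iff.1 (ht r s t ▸
      add_below_iff.2 ⟨add_below_iff.2 ⟨h1, h2⟩, h.mul_comm r t ▸ h3⟩))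
  have hxz : ¬ x * z ≼ p := htri hxy hyz
  have hyw : ¬ y * w ≼ p := htri hyz hzw
  have hyx : y * x ≼ p := h.mul_comm x y ▸ hxy
  have hzy : z * y ≼ p := h.mul_comm y z ▸ hyz
  have hwz : w * z ≼ p := h.mul_comm z w ▸ hzw
  have hwx : ¬ w * x ≼ p := h.mul_comm x w ▸ hxw
  have hzx : ¬ z * x ≼ p := h.mul_comm x z ▸ hxz
  have hwy : ¬ w * y ≼ p := h.mul_comm y w ▸ hyw
  have hl : ∀ {r t : A}, r * t ≼ p → ¬ r ≼ p := h.not_below_of_mul_below hpo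
  have hsep : ∀ a b : SR6.{u}, (a ≼ .e3 ↔ b ≼ .e3) →
      (∀ i : Fin 4, a * ![SR6.e2, .e6, .e5, .e4] i ≼ .e3 ↔
        b * ![SR6.e2, .e6, .e5, .e4] i ≼ .e3) → a = b := by
    decide
  refine V.mem_of_separation (S := SR6.alg) h SR6.isThreeNil (X := Fin 4) ![x, y, z, w]
    ![SR6.e2, .e6, .e5, .e4] p SR6.e3 hpo nofun ?_ ?_ hsep ?_ hV
  · intro i
    fin_cases i
    · exact iff_of_false (hl hxy) nofun
    · exact iff_of_false (hl hyx) nofun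
    · exact iff_of_false (hl hzw) nofun
    · exact iff_of_false (hl hwz) nofun
  · intro i j
    fin_cases i <;> fin_cases j
    · exact iff_of_false (hso x) nofun
    · exact iff_of_true hxy rfl
    · exact iff_of_false hxz nofun
    · exact iff_of_false hxw nofun
    · exact iff_of_true hyx rfl
    · exact iff_of_false (hso y) nofun
    · exact iff_of_true hyz rfl
    · exact iff_of_false hyw nofun
    · exact iff_of_false hzx nofun
    · exact iff_of_true hzy rfl
    · exact iff_of_false (hso z) nofun
    · exact iff_of_true hzw rfl
    · exact iff_of_false hwx nofun
    · exact iff_of_false hwy nofun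
    · exact iff_of_true hwz rfl
    · exact iff_of_false (hso w) nofun
  · rintro (_ | _)
    · exact ⟨.mul (.var 0) (.var 0), rfl⟩
    · exact ⟨.var 0, rfl⟩
    · exact ⟨.mul (.var 0) (.var 1), rfl⟩
    · exact ⟨.var 3, rfl⟩
    · exact ⟨.var 2, rfl⟩
    · exact ⟨.var 1, rfl⟩

end AIVariety

/-! ### Comparison of terms -/

/-- A triangle-free symmetric relation in which all paths with three edges close up has a proper
two-colouring in which two given non-adjacent non-isolated points have the same colour. -/
theorem exists_coloring {X : Type*} {E : X → X → Prop} (hsymm : ∀ {x y}, E x y → E y x)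
    (htri : ∀ {x y z}, E x y → E y z → ¬ E x z)
    (hpath : ∀ {x y z w}, E x y → E y z → E z w → E x w) {a b : X} (hab : ¬ E a b) :
    ∃ χ : X → Prop, (∀ x y, E x y → (χ x ↔ ¬ χ y)) ∧
      ((∃ c, E a c) → (∃ c, E b c) → (χ a ↔ χ b)) := by
  -- For a non-isolated `x`, `N x` is the opposite side of its complete bipartite component and `M
  -- x` is its own side; crossing an edge swaps the two.
  let N : X → Set X := fun x => {y | E x y}
  let M : X → Set X := fun x => {z | ∃ y, E x y ∧ E y z}
  have hNM : ∀ {x y}, E x y → N y = M x := fun {x y} h => Set.ext fun z =>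
    ⟨fun hz => ⟨y, h, hz⟩, fun ⟨u, h1, h2⟩ => hpath (hsymm h) h1 h2⟩
  -- A linear order on vertex sets chooses one side of every component at once.
  let r : Set X → Set X → Prop := WellOrderingRel
  let χ : X → Prop := fun x => r (N x) (M x)
  have hχ : ∀ x y, E x y → (χ x ↔ ¬ χ y) := by
    intro x y h
    have hne : N x ≠ M x := by
      intro heq
      obtain ⟨u, h1, h2⟩ : y ∈ M x := heq ▸ (h : y ∈ N x)
      exact htri h1 h2 h
    simp only [χ, hNM h, ← hNM (hsymm h)]
    constructor
    · exact fun h1 h2 => asymm_of r h1 h2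
    · intro h1
      rcases trichotomous_of r (N x) (M x) with h2 | h2 | h2
      · exact h2
      · exact absurd h2 hne
      · exact absurd h2 h1
  by_cases hc : χ a ↔ χ b
  · exact ⟨χ, hχ, fun _ _ => hc⟩
  -- Swap the colours on the component of `b`. It does not contain `a`, which is not adjacent to `b`
  -- and, having the other colour, is not on the side of `b`.
  refine ⟨fun x => χ x ↔ ¬ (x ∈ N b ∨ x ∈ M b), fun x y h => ?_, fun _ ⟨c, hbc⟩ => ?_⟩
  · have h1 : x ∈ N b → y ∈ M b := fun hx => ⟨x, hx, h⟩
    have h2 : y ∈ N b → x ∈ M b := fun hy => ⟨y, hy, hsymm h⟩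
    have h3 : x ∈ M b → y ∈ N b := fun ⟨u, hu, hx⟩ => hpath hu hx h
    have h4 : y ∈ M b → x ∈ N b := fun ⟨u, hu, hy⟩ => hpath hu hy (hsymm h)
    have := hχ x y h
    tauto
  · have hb : b ∈ M b := ⟨c, hbc, hsymm hbc⟩
    have ha : a ∉ N b := fun h => hab (hsymm h)
    have ha' : a ∉ M b := by
      rintro ⟨u, h1, h2⟩
      refine hc ?_
      have h3 := hχ b u h1
      have h4 := hχ u a h2
      tauto
    tauto

namespace PolyTerm

variable {X : Type*} {A : Type u} [AISemiring A] {o : A}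

theorem eval_below_eval_of_flatA (h : IsThreeNil o) (hnull : ∀ x y : A, x * y = o) (φ : X → A)
    {s t : PolyTerm X} (hst : ∀ v : X → FlatA.{u}, s.eval v = t.eval v) :
    t.eval φ ≼ s.eval φ := by
  by_cases hs : s.Nonlin
  · have hc := (eval_below_iff h φ s _).1 (below_refl _)
    have : s.eval φ = o := by
      rw [← h.top_below_iff]
      rcases hs with hs | ⟨x, y, hxy⟩
      · exact hc.2.2 hs
      · exact hnull (φ x) (φ y) ▸ hc.2.1 x y hxy
    rw [this]
    exact h.add_top _
  · exact eval_below_eval_of_not_nonlin h FlatA.isThreeNil (q := FlatA.a) nofun hst hs φ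

/-- With `c = s.eval φ`, every two-colouring of the graph `φ x * φ y ≼ c` gives an assignment into
`S_c(ab)` with `s`, hence `t`, below `ab`. Varying the colouring shows that all words of `t` lie
below `c`. -/
theorem eval_below_eval_of_flatAB (h : IsThreeNil o) (ht : TriangleLaw o) (hpath : PathLaw A)
    (φ : X → A) {s t : PolyTerm X} (hst : ∀ v : X → FlatAB.{u}, s.eval v = t.eval v) :
    t.eval φ ≼ s.eval φ := by
  classical
  obtain ⟨c, hc⟩ : ∃ c, c = s.eval φ := ⟨_, rfl⟩
  rw [← hc]
  by_cases hco : c = o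
  · rw [hco]
    exact h.add_top _
  have hoc : ¬ o ≼ c := by rwa [h.top_below_iff]
  obtain ⟨hlin, hedge, hlong⟩ := (eval_below_iff h φ s c).1 (hc ▸ below_refl _)
  by_cases hs : s.Nonlin
  swap
  · rw [hc]
    exact eval_below_eval_of_not_nonlin h FlatAB.isThreeNil (q := FlatAB.a) nofun hst hs φ
  obtain ⟨x₀, y₀, hxy₀⟩ : ∃ x y, s.Edge x y := hs.resolve_left fun hl => hoc (hlong hl)
  let E : X → X → Prop := fun x y => φ x * φ y ≼ c
  have hsymm : ∀ {x y}, E x y → E y x := fun {x y} hxy => by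
    simpa only [E, h.mul_comm] using hxy
  have hirr : ∀ x, ¬ E x x := fun x hx => hoc (h.sq (φ x) ▸ hx)
  have htri : ∀ {x y z}, E x y → E y z → ¬ E x z := fun {x y z} h1 h2 h3 =>
    hoc (ht (φ x) (φ y) (φ z) ▸ add_below_iff.2 ⟨add_below_iff.2 ⟨h1, h2⟩, hsymm h3⟩)
  have hpath' : ∀ {x y z w}, E x y → E y z → E z w → E x w := fun {x y z w} h1 h2 h3 => by
    have := add_below_iff.2 ⟨add_below_iff.2 ⟨h1, h2⟩, h3⟩
    rw [hpath] at this
    exact (add_below_iff.1 this).2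
  have hdisj : ∀ {x y}, E x y → ¬ φ x ≼ c := fun hxy => h.not_below_of_mul_below hco hxy
  let v : (X → Prop) → X → FlatAB.{u} := fun χ x =>
    if φ x ≼ c then .ab else if ∃ y, E x y then (if χ x then .a else .b) else .z
  have hva : ∀ {χ x}, v χ x = .a → (∃ y, E x y) ∧ χ x := by
    intro χ x hx
    simp only [v] at hx
    split_ifs at hx with h1 h2 h3
    exact ⟨h2, h3⟩
  have hvb : ∀ {χ x}, v χ x = .b → (∃ y, E x y) ∧ ¬ χ x := by
    intro χ x hx
    simp only [v] at hx
    split_ifs at hx with h1 h2 h3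
    exact ⟨h2, h3⟩
  have hprod : ∀ p q : FlatAB.{u}, p * q ≼ .ab → (p = .a ∧ q = .b) ∨ (p = .b ∧ q = .a) := by
    decide
  have key : ∀ χ : X → Prop, (∀ x y, E x y → (χ x ↔ ¬ χ y)) → t.eval (v χ) ≼ .ab := by
    intro χ hχ
    rw [← hst, eval_below_iff FlatAB.isThreeNil]
    refine ⟨fun x hx => ?_, fun x y hxy => ?_, fun hl => absurd (hlong hl) hoc⟩
    · simp only [v, if_pos (hlin x hx)]
      rfl
    · have hE : E x y := hedge x y hxy
      have hE' := hsymm hE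
      have hχ' := hχ x y hE
      simp only [v, if_neg (hdisj hE), if_neg (hdisj hE'), if_pos (Exists.intro y hE),
        if_pos (Exists.intro x hE')]
      by_cases hy : χ y
      · rw [if_pos hy, if_neg (fun hx => hχ'.1 hx hy)]
        rfl
      · rw [if_neg hy, if_pos (hχ'.2 hy)]
        rfl
  have key' : ∀ χ : X → Prop, (∀ x y, E x y → (χ x ↔ ¬ χ y)) → _ := fun χ hχ =>
    (eval_below_iff FlatAB.isThreeNil _ t _).1 (key χ hχ)
  -- Any proper colouring will do here, so the two distinguished points are both taken to be `x₀`.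
  obtain ⟨χ₀, hχ₀, -⟩ := exists_coloring (E := E) hsymm htri hpath' (hirr x₀)
  rw [eval_below_iff h]
  refine ⟨fun x hx => ?_, fun x y hxy => ?_, fun hl => ?_⟩
  · have := (key' χ₀ hχ₀).1 x hx
    by_contra hx'
    simp only [v, if_neg hx'] at this
    revert this
    split_ifs <;> decide
  · by_contra hE
    -- A colouring that gives `x` and `y` the same colour keeps their product from being `ab`.
    obtain ⟨χ, hχ, hab⟩ := exists_coloring (E := E) hsymm htri hpath' hE
    rcases hprod _ _ ((key' χ hχ).2.1 x y hxy) with ⟨h1, h2⟩ | ⟨h1, h2⟩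
    · exact (hvb h2).2 ((hab (hva h1).1 (hvb h2).1).1 (hva h1).2)
    · exact (hvb h1).2 ((hab (hvb h1).1 (hva h2).1).2 (hva h2).2)
  · exact absurd ((key' χ₀ hχ₀).2.2 hl) (by decide)

/-- Comparison of two terms with the same value throughout `SR₆`, the two-letter words of the
first forming a bipartite graph. -/
theorem eval_below_eval_of_sr6 (h : IsThreeNil o) (φ : X → A) {s t : PolyTerm X}
    (hst : ∀ v : X → SR6.{u}, s.eval v = t.eval v) {χ : X → Prop}
    (hχ : s.eval φ ≠ o → ∀ x y, s.Edge x y → (χ x ↔ ¬ χ y)) :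
    t.eval φ ≼ s.eval φ := by
  classical
  obtain ⟨c, hc⟩ : ∃ c, c = s.eval φ := ⟨_, rfl⟩
  rw [← hc] at hχ ⊢
  by_cases hco : c = o
  · rw [hco]
    exact h.add_top _
  replace hχ := hχ hco
  have hoc : ¬ o ≼ c := by rwa [h.top_below_iff]
  obtain ⟨hlin, hedge, hlong⟩ := (eval_below_iff h φ s c).1 (hc ▸ below_refl _)
  by_cases hs : s.Nonlin
  swap
  · rw [hc]
    exact eval_below_eval_of_not_nonlin h SR6.isThreeNil (q := SR6.e5) nofun hst hs φ
  have hdisj : ∀ {x y}, s.Edge x y → ¬ s.Lin x ∧ ¬ s.Lin y := fun {x y} hxy =>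
    ⟨fun hx => h.not_below_of_mul_below hco (hedge x y hxy) (hlin x hx),
      fun hy => h.not_below_of_mul_below hco (h.mul_comm (φ x) (φ y) ▸ hedge x y hxy)
        (hlin y hy)⟩
  let D : X → Prop := fun x => ∃ y, s.Edge x y ∨ s.Edge y x
  -- The sides of the bipartition are {2, 5} and {4, 6}. Across them only 2 · 4 differs from 3, so
  -- `B`, the set of vertices sent to 2 or 4, may be any set containing no edge of `s`.
  let v : (X → Prop) → X → SR6.{u} := fun B x =>
    if s.Lin x then .e3 else if D x then
      (if χ x then (if B x then .e2 else .e5) else (if B x then .e4 else .e6)) else .e1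
  have key : ∀ B : X → Prop, (∀ x y, s.Edge x y → ¬ (B x ∧ B y)) → _ := fun B hB =>
    (eval_below_iff SR6.isThreeNil (v B) t .e3).1 (by
      rw [← hst, eval_below_iff SR6.isThreeNil]
      refine ⟨fun x hx => ?_, fun x y hxy => ?_, fun hl => absurd (hlong hl) hoc⟩
      · simp only [v, if_pos hx]
        rfl
      · have hx : D x := ⟨y, Or.inl hxy⟩
        have hy : D y := ⟨x, Or.inr hxy⟩
        have h1 := hχ x y hxy
        have h2 := hB x y hxy
        simp only [v, if_neg (hdisj hxy).1, if_neg (hdisj hxy).2, if_pos hx, if_pos hy]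
        split_ifs <;> first | decide | tauto)
  have key₀ := key (fun _ => False) fun _ _ _ hB => hB.1
  rw [eval_below_iff h]
  refine ⟨fun x hx => hlin x ?_, fun x y hxy => ?_, fun hl => ?_⟩
  · have := key₀.1 x hx
    by_contra hx'
    simp only [v, if_neg hx'] at this
    revert this
    split_ifs <;> decide
  · by_contra hE
    -- The set {x, y} contains no edge of `s`. With it as `B`, neither `x` nor `y` takes the value 5
    -- or 6, so their product is 1, which is not below 3.
    have hB : ∀ x' y', s.Edge x' y' → ¬ ((x' = x ∨ x' = y) ∧ (y' = x ∨ y' = y)) := by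
      rintro x' y' h1 ⟨rfl | rfl, rfl | rfl⟩
      · have := hχ _ _ h1
        tauto
      · exact hE (hedge _ _ h1)
      · exact hE (h.mul_comm (φ x') (φ y') ▸ hedge _ _ h1)
      · have := hχ _ _ h1
        tauto
    have := (key (fun z => z = x ∨ z = y) hB).2.1 x y hxy
    revert this
    simp only [v, true_or, or_true, if_true]
    split_ifs <;> decide
  · exact absurd (key₀.2.2 hl) (by decide)

end PolyTerm

/-! ### Algebras of vertex sets of graphs -/

/-- The nonempty sets of vertices of a graph, with two additional elements. -/
inductive GraphAlg (G : SimpleGraph ℕ) : Type u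
  | top
  | mid
  | pts (X : Set ℕ) (hX : X.Nonempty)

namespace GraphAlg

variable {G : SimpleGraph ℕ}

/-- The sum of two vertex sets is their union. -/
def add : GraphAlg.{u} G → GraphAlg.{u} G → GraphAlg.{u} G
  | pts X hX, pts Y _ => pts (X ∪ Y) hX.inl
  | mid, mid => mid
  | _, _ => top

open Classical in
/-- The product of two vertex sets is `mid` if they are completely joined, and `top`
otherwise. -/
noncomputable def mul : GraphAlg.{u} G → GraphAlg.{u} G → GraphAlg.{u} G
  | pts X _, pts Y _ => if ∀ x ∈ X, ∀ y ∈ Y, G.Adj x y then mid else top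
  | _, _ => top

theorem mul_cases (x y : GraphAlg.{u} G) : mul x y = mid ∨ mul x y = top := by
  rcases x with _ | _ | ⟨X, hX⟩ <;> rcases y with _ | _ | ⟨Y, hY⟩ <;>
    first | exact Or.inr rfl | (simp only [mul]; split_ifs <;> simp)

theorem mul_eq_mid_iff {X Y : Set ℕ} {hX : X.Nonempty} {hY : Y.Nonempty} :
    mul (pts.{u} (G := G) X hX) (pts Y hY) = mid ↔ ∀ x ∈ X, ∀ y ∈ Y, G.Adj x y := by
  simp [mul]

protected theorem ext_mid {x y : GraphAlg.{u} G} (hx : x = mid ∨ x = top)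
    (hy : y = mid ∨ y = top) (h : x = mid ↔ y = mid) : x = y := by
  rcases hx with rfl | rfl <;> rcases hy with rfl | rfl <;> simp at h ⊢

protected theorem mul_comm' (x y : GraphAlg.{u} G) : mul x y = mul y x := by
  rcases x with _ | _ | ⟨X, hX⟩ <;> rcases y with _ | _ | ⟨Y, hY⟩ <;> try rfl
  refine GraphAlg.ext_mid (mul_cases _ _) (mul_cases _ _) ?_
  rw [mul_eq_mid_iff, mul_eq_mid_iff]
  exact ⟨fun h y hy x hx => (h x hx y hy).symm, fun h x hx y hy => (h y hy x hx).symm⟩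

protected theorem mul_mul' (x y z : GraphAlg.{u} G) : mul (mul x y) z = top := by
  rcases mul_cases x y with h | h <;> rw [h] <;> cases z <;> rfl

theorem add_top' (x : GraphAlg.{u} G) : add x top = top := by cases x <;> rfl

protected theorem add_comm' (x y : GraphAlg.{u} G) : add x y = add y x := by
  rcases x with _ | _ | ⟨X, hX⟩ <;> rcases y with _ | _ | ⟨Y, hY⟩ <;> try rfl
  simp only [add, Set.union_comm]

protected theorem mul_add' (x y z : GraphAlg.{u} G) :
    mul x (add y z) = add (mul x y) (mul x z) := by
  rcases x with _ | _ | ⟨X, hX⟩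
  · rfl
  · rfl
  rcases y with _ | _ | ⟨Y, hY⟩ <;> rcases z with _ | _ | ⟨Z, hZ⟩ <;>
    first
    | rfl
    | exact (add_top' _).symm
    | exact ((GraphAlg.add_comm' _ _).trans (add_top' _)).symm
    | skip
  refine GraphAlg.ext_mid (mul_cases _ _) ?_ ?_
  · rcases mul_cases (pts X hX) (pts Y hY) with h | h <;>
      rcases mul_cases (pts X hX) (pts Z hZ) with h' | h' <;> rw [h, h'] <;> simp [add]
  · have : ∀ {x y : GraphAlg.{u} G}, (x = mid ∨ x = top) → (y = mid ∨ y = top) →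
        (add x y = mid ↔ x = mid ∧ y = mid) := by
      rintro x y (rfl | rfl) (rfl | rfl) <;> simp [add]
    rw [this (mul_cases _ _) (mul_cases _ _), add, mul_eq_mid_iff, mul_eq_mid_iff, mul_eq_mid_iff]
    simp only [Set.mem_union, or_imp, forall_and]

noncomputable instance : AISemiring (GraphAlg.{u} G) where
  add := add
  mul := mul
  add_assoc := by
    intro x y z
    change add (add x y) z = add x (add y z)
    rcases x with _ | _ | ⟨X, hX⟩ <;> rcases y with _ | _ | ⟨Y, hY⟩ <;>
      rcases z with _ | _ | ⟨Z, hZ⟩ <;> try rfl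
    simp only [add, Set.union_assoc]
  add_comm := GraphAlg.add_comm'
  mul_assoc := fun x y z => by
    change mul (mul x y) z = mul x (mul y z)
    rw [GraphAlg.mul_mul', GraphAlg.mul_comm' x, GraphAlg.mul_mul']
  left_distrib := GraphAlg.mul_add'
  right_distrib := fun x y z => by
    change mul (add x y) z = add (mul x z) (mul y z)
    rw [GraphAlg.mul_comm' _ z, GraphAlg.mul_add', GraphAlg.mul_comm' z, GraphAlg.mul_comm' z]
  add_self := by
    intro x
    change add x x = x
    rcases x with _ | _ | ⟨X, hX⟩ <;> try rfl
    simp only [add, Set.union_self]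

/-- The bundled algebra. -/
noncomputable def alg (G : SimpleGraph ℕ) : AISemiringAlg.{u} where
  carrier := GraphAlg G
  nonempty := ⟨top⟩

theorem isThreeNil : IsThreeNil (top : GraphAlg.{u} G) where
  mul_comm := GraphAlg.mul_comm'
  add_top := add_top'
  sq := by
    intro x
    refine (mul_cases x x).resolve_left fun h => ?_
    rcases x with _ | _ | ⟨X, ⟨x, hx⟩⟩
    · cases h
    · cases h
    · exact G.loopless.irrefl x (mul_eq_mid_iff.1 h x hx x hx)
  mul_mul := GraphAlg.mul_mul'
  add_mul := by
    intro x y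
    change add x (mul x y) = top
    rcases x with _ | _ | ⟨X, hX⟩
    · rfl
    · rfl
    · rcases mul_cases (pts X hX) y with h | h <;> rw [h] <;> rfl

/-- A vertex in a vertex set. -/
noncomputable def rep : GraphAlg.{u} G → ℕ
  | pts _ hX => hX.some
  | _ => 0

/-- Completely joined sets have adjacent representatives, so a colouring of `G` can be pulled back
to the variables of a term. -/
theorem adj_rep {x y : GraphAlg.{u} G} (h : x * y ≠ top) : G.Adj (rep x) (rep y) := by
  have h' : mul x y = mid := (mul_cases x y).resolve_right h
  rcases x with _ | _ | ⟨X, hX⟩ <;> rcases y with _ | _ | ⟨Y, hY⟩ <;> try cases h'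
  exact mul_eq_mid_iff.1 h' _ hX.some_mem _ hY.some_mem

end GraphAlg

/-! ### Odd cycles -/

/-- The cycle through `0, …, m - 1`. -/
def cycle (m : ℕ) : SimpleGraph ℕ where
  Adj i j := (i + 1 = j ∧ j < m) ∨ (j + 1 = i ∧ i < m) ∨
    -- The bounds `1 ≤ j` and `1 ≤ i` exclude a loop at 0 when `m = 1`. Vertices from `m` on are
    -- isolated.
    (i = 0 ∧ j + 1 = m ∧ 1 ≤ j) ∨ (j = 0 ∧ i + 1 = m ∧ 1 ≤ i)
  symm := ⟨fun i j h => by omega⟩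
  loopless := ⟨fun i h => by omega⟩

/-- An odd cycle without one of its vertices is bipartite. -/
theorem cycle_coloring {k d i j : ℕ} (hd : d < 2 * k + 1) (hi : i ≠ d) (hj : j ≠ d)
    (h : (cycle (2 * k + 1)).Adj i j) :
    (i < d ↔ i % 2 = 0) ↔ ¬ (j < d ↔ j % 2 = 0) := by
  -- Parity alternates except on the edge from 0 to `2 * k`. Reversing the colours beyond the
  -- deleted vertex `d` repairs that edge, and no remaining edge joins consecutive vertices across
  -- `d`.
  simp only [cycle] at h
  omega

namespace AITerm

/-- The term `x₀x₁ + x₁x₂ + ⋯ + xₖxₖ₊₁`. -/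
def pathSum : ℕ → AITerm
  | 0 => mul (var 0) (var 1)
  | k + 1 => add (pathSum k) (mul (var (k + 1)) (var (k + 2)))

/-- The identity saying that cycles of length `k + 2` evaluate to the greatest element. -/
def cycleIdentity (k : ℕ) : AITerm × AITerm :=
  (add (pathSum k) (mul (var (k + 1)) (var 0)), mul (var 0) (var 0))

theorem eval_pathSum_below_iff {S : Type u} [AISemiring S] (v : ℕ → S) (k : ℕ) (c : S) :
    (pathSum k).eval v ≼ c ↔ ∀ i ≤ k, v i * v (i + 1) ≼ c := by
  induction k with
  | zero => simp [pathSum, eval]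
  | succ k ih =>
    rw [pathSum, eval, add_below_iff, ih]
    constructor
    · rintro ⟨h1, h2⟩ i hi
      rcases Nat.lt_or_ge k i with h | h
      · obtain rfl : i = k + 1 := by omega
        exact h2
      · exact h1 i h
    · exact fun h => ⟨fun i hi => h i (by omega), h (k + 1) le_rfl⟩

/-- A product below some `c ≠ 1` joins {2, 5} to its complement, so sides alternate along the cycle.
Its length `2 * k + 3` is odd, which is impossible. -/
theorem sr6_satisfies_cycleIdentity (k : ℕ) :
    SatisfiesIdentity SR6.{u} (cycleIdentity (2 * k + 1)) := by
  intro v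
  obtain ⟨c, hc⟩ : ∃ c, c = (cycleIdentity (2 * k + 1)).1.eval v := ⟨_, rfl⟩
  have h1 : (cycleIdentity (2 * k + 1)).1.eval v ≼ c := hc ▸ below_refl _
  have h2 : (cycleIdentity (2 * k + 1)).2.eval v = .e1 := SR6.isThreeNil.sq _
  rw [← hc, h2]
  by_contra hc1
  rw [cycleIdentity, eval, add_below_iff, eval_pathSum_below_iff] at h1
  obtain ⟨P, side⟩ : ∃ P : SR6.{u} → Prop, ∀ x y c, c ≠ .e1 → x * y ≼ c → (P x ↔ ¬ P y) :=
    ⟨fun x => x = .e2 ∨ x = .e5, by decide⟩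
  have step : ∀ i ≤ 2 * k + 2, (P (v i) ↔ (i % 2 = 0 ↔ P (v 0))) := by
    intro i
    induction i with
    | zero => simp
    | succ i ih =>
      intro hi
      have h3 := ih (by omega)
      have h4 := side _ _ _ hc1 (h1.1 i (by omega))
      have h5 : (i + 1) % 2 = 0 ↔ ¬ i % 2 = 0 := by omega
      clear hc hc1 h1 h2 ih side
      tauto
  have h3 := step (2 * k + 2) le_rfl
  have h4 := side _ _ _ hc1 h1.2
  have h5 : (2 * k + 2) % 2 = 0 := by omega
  exact iff_not_self ((h3.trans (iff_true_left h5)).symm.trans h4)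

/-- Assigning to each variable the singleton of its index makes all products along the cycle equal
to `mid`, whereas squares are `top`. -/
theorem not_satisfies_cycleIdentity (k : ℕ) :
    ¬ SatisfiesIdentity (GraphAlg.{u} (cycle (2 * k + 3))) (cycleIdentity (2 * k + 1)) := by
  intro h
  have h1 := h fun i => .pts {i} (Set.singleton_nonempty i)
  have h2 : (cycleIdentity (2 * k + 1)).1.eval
      (fun i => (.pts {i} (Set.singleton_nonempty i) : GraphAlg.{u} (cycle (2 * k + 3)))) ≼
        .mid := by
    have hmid : ∀ {i j : ℕ}, (cycle (2 * k + 3)).Adj i j →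
        (.pts {i} (Set.singleton_nonempty i) * .pts {j} (Set.singleton_nonempty j) :
          GraphAlg.{u} (cycle (2 * k + 3))) ≼ .mid := by
      intro i j hij
      have : (.pts {i} (Set.singleton_nonempty i) * .pts {j} (Set.singleton_nonempty j) :
          GraphAlg.{u} (cycle (2 * k + 3))) = .mid :=
        GraphAlg.mul_eq_mid_iff.2 (by rintro _ rfl _ rfl; exact hij)
      rw [this]
      exact below_refl _
    rw [cycleIdentity, eval, add_below_iff, eval_pathSum_below_iff]
    refine ⟨fun i hi => hmid ?_, hmid ?_⟩
    · exact Or.inl ⟨rfl, by omega⟩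
    · exact Or.inr (Or.inr (Or.inr ⟨rfl, by omega, by omega⟩))
  rw [h1] at h2
  have h3 := GraphAlg.isThreeNil.sq
    (.pts {0} (Set.singleton_nonempty 0) : GraphAlg.{u} (cycle (2 * k + 3)))
  simp only [cycleIdentity, eval] at h2
  rw [h3, GraphAlg.isThreeNil.top_below_iff] at h2
  cases h2

end AITerm

/-- The algebra of a long odd cycle satisfies all identities of `SR₆` in few variables. -/
theorem GraphAlg.eval_below_eval {k N : ℕ} (hN : N < 2 * k + 1) {s t : PolyTerm ℕ}
    (hs : ∀ x y, s.Edge x y → x < N ∧ y < N)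
    (hst : ∀ v : ℕ → SR6.{u}, s.eval v = t.eval v) (φ : ℕ → GraphAlg.{u} (cycle (2 * k + 1))) :
    t.eval φ ≼ s.eval φ := by
  -- Fewer variables than vertices: some vertex `d` represents no value of a variable below `N`, and
  -- deleting it leaves a bipartite graph.
  obtain ⟨d, hd, hd'⟩ : ∃ d ∈ Finset.range (2 * k + 1),
      d ∉ (Finset.range N).image fun x => rep (φ x) := by
    refine Finset.exists_mem_notMem_of_card_lt_card ?_
    refine Finset.card_image_le.trans_lt ?_
    simpa using hN
  have hne : ∀ x < N, rep (φ x) ≠ d := fun x hx h =>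
    hd' (Finset.mem_image.2 ⟨x, Finset.mem_range.2 hx, h⟩)
  refine PolyTerm.eval_below_eval_of_sr6 isThreeNil φ hst
    (χ := fun x => rep (φ x) < d ↔ rep (φ x) % 2 = 0) fun ho x y hxy => ?_
  refine cycle_coloring (Finset.mem_range.1 hd) (hne x (hs x y hxy).1) (hne y (hs x y hxy).2)
    (adj_rep fun h => ho ?_)
  rw [← isThreeNil.top_below_iff, ← h]
  exact ((PolyTerm.eval_below_iff isThreeNil φ s _).1 (below_refl _)).2.1 x y hxy

/-! ### The subvarieties -/

namespace AIVariety

theorem models_of_mem_generatedBy {S A : AISemiringAlg.{u}} {E : Set (AITerm × AITerm)}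
    (hS : ∀ p ∈ E, SatisfiesIdentity S p) (hA : A ∈ (generatedBy S).carrier) :
    ∀ p ∈ E, SatisfiesIdentity A p := hA (models E) hS

theorem isThreeNil_of_mem {A : AISemiringAlg.{u}} (hA : A ∈ (generatedBy SR6.alg).carrier) :
    ∃ o : A, IsThreeNil o ∧ TriangleLaw o :=
  (AITerm.satisfies_baseIdentities_iff A).1 (models_of_mem_generatedBy
    ((AITerm.satisfies_baseIdentities_iff SR6.alg).2 ⟨_, SR6.isThreeNil, SR6.triangleLaw⟩) hA)

theorem mem_generatedBy_flatAB {A : AISemiringAlg.{u}} {o : A} (h : IsThreeNil o)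
    (ht : TriangleLaw o) (hpath : PathLaw A) : A ∈ (generatedBy FlatAB.alg).carrier :=
  mem_generatedBy_of_eval_eq fun _ _ hst => below_antisymm
    (PolyTerm.eval_below_eval_of_flatAB h ht hpath id fun v => (hst v).symm)
    (PolyTerm.eval_below_eval_of_flatAB h ht hpath id hst)

theorem mem_generatedBy_flatA {A : AISemiringAlg.{u}} {o : A} (h : IsThreeNil o)
    (hnull : ∀ x y : A, x * y = o) : A ∈ (generatedBy FlatA.alg).carrier :=
  mem_generatedBy_of_eval_eq fun _ _ hst => below_antisymm
    (PolyTerm.eval_below_eval_of_flatA h hnull id fun v => (hst v).symm)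
    (PolyTerm.eval_below_eval_of_flatA h hnull id hst)

theorem generatedBy_flatAB :
    generatedBy FlatAB.alg.{u} = models (insert AITerm.pathIdentity AITerm.baseIdentities) := by
  refine le_antisymm (generatedBy_le_iff.2 (Set.forall_mem_insert.2 ⟨?_, ?_⟩)) fun A hA => ?_
  · exact (AITerm.satisfies_pathIdentity_iff FlatAB.alg).2 FlatAB.pathLaw
  · exact (AITerm.satisfies_baseIdentities_iff FlatAB.alg).2
      ⟨_, FlatAB.isThreeNil, FlatAB.triangleLaw⟩
  · obtain ⟨h1, h2⟩ := Set.forall_mem_insert.1 hA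
    obtain ⟨o, ho, ht⟩ := (AITerm.satisfies_baseIdentities_iff A).1 h2
    exact mem_generatedBy_flatAB ho ht ((AITerm.satisfies_pathIdentity_iff A).1 h1)

theorem generatedBy_flatA :
    generatedBy FlatA.alg.{u} = models (insert AITerm.nullIdentity AITerm.baseIdentities) := by
  refine le_antisymm (generatedBy_le_iff.2 (Set.forall_mem_insert.2 ⟨?_, ?_⟩)) fun A hA => ?_
  · exact fun _ => rfl
  · exact (AITerm.satisfies_baseIdentities_iff FlatA.alg).2
      ⟨_, FlatA.isThreeNil, fun _ _ _ => rfl⟩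
  · obtain ⟨h1, h2⟩ := Set.forall_mem_insert.1 hA
    obtain ⟨o, ho, -⟩ := (AITerm.satisfies_baseIdentities_iff A).1 h2
    exact mem_generatedBy_flatA ho ((AITerm.satisfies_nullIdentity_iff ho).1 h1)

theorem trivial_eq_models : trivial.{u} = models {(.var 0, .var 1)} := by
  refine AIVariety.ext (Set.ext fun A => ?_)
  constructor
  · rintro (hA : Subsingleton A) p - v
    exact Subsingleton.elim _ _
  · intro h
    exact ⟨fun x y => h _ rfl (assign x y x x)⟩

theorem trivial_lt_flatA : trivial < generatedBy FlatA.alg.{u} := by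
  refine lt_of_le_not_ge (trivial_le _) fun h => ?_
  have : Subsingleton FlatA.{u} := generatedBy_le_iff.1 h
  exact absurd (Subsingleton.elim FlatA.a FlatA.z) nofun

theorem flatA_lt_flatAB : generatedBy FlatA.alg.{u} < generatedBy FlatAB.alg.{u} := by
  refine lt_of_le_not_ge (generatedBy_le_iff.2 ?_) fun h => ?_
  · exact flatA_mem (A := FlatAB.alg) (o := FlatAB.z) (p := FlatAB.a) FlatAB.isThreeNil nofun (mem_generatedBy _)
  · rw [generatedBy_flatA, generatedBy_le_iff] at h
    have := (AITerm.satisfies_nullIdentity_iff (A := FlatAB.alg) FlatAB.isThreeNil).1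
      (h _ (Set.mem_insert _ _)) FlatAB.a FlatAB.b
    cases this

theorem flatAB_lt_sr6 : generatedBy FlatAB.alg.{u} < generatedBy SR6.alg.{u} := by
  refine lt_of_le_not_ge (generatedBy_le_iff.2 ?_) fun h => ?_
  · exact flatAB_mem (A := SR6.alg) (o := SR6.e1) (x := SR6.e5) (y := SR6.e6) SR6.isThreeNil nofun (mem_generatedBy _)
  · rw [generatedBy_flatAB, generatedBy_le_iff] at h
    exact SR6.not_pathLaw
      ((AITerm.satisfies_pathIdentity_iff SR6.alg).1 (h _ (Set.mem_insert _ _)))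

/-- Properness excludes `SR6`, which forces the path law on all members; which of `FlatAB` and
`FlatA` belong to `W` then decides the case. -/
theorem eq_of_lt_sr6 {W : AIVariety.{u}} (hW : W < generatedBy SR6.alg.{u}) :
    W = trivial ∨ W = generatedBy FlatA.alg ∨ W = generatedBy FlatAB.alg := by
  have hbase : ∀ A ∈ W.carrier, ∃ o : A, IsThreeNil o ∧ TriangleLaw o :=
    fun A hA => isThreeNil_of_mem (hW.le hA)
  have hpath : ∀ A ∈ W.carrier, PathLaw A := by
    intro A hA
    by_contra hn
    obtain ⟨o, h, ht⟩ := hbase A hA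
    exact hW.not_ge (generatedBy_le_iff.2 (sr6_mem h ht hn hA))
  by_cases hAB : FlatAB.alg ∈ W.carrier
  · refine Or.inr (Or.inr (le_antisymm (fun A hA => ?_) (generatedBy_le_iff.2 hAB)))
    obtain ⟨o, h, ht⟩ := hbase A hA
    exact mem_generatedBy_flatAB h ht (hpath A hA)
  by_cases hA' : FlatA.alg ∈ W.carrier
  · refine Or.inr (Or.inl (le_antisymm (fun A hA => ?_) (generatedBy_le_iff.2 hA')))
    obtain ⟨o, h, -⟩ := hbase A hA
    refine mem_generatedBy_flatA h fun x y => ?_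
    by_contra hxy
    exact hAB (flatAB_mem h hxy hA)
  · refine Or.inl (le_antisymm (fun A hA => ?_) (trivial_le W))
    obtain ⟨o, h, -⟩ := hbase A hA
    have key : ∀ x : A, x = o := fun x => by
      by_contra hx
      exact hA' (flatA_mem h hx hA)
    exact ⟨fun x y => (key x).trans (key y).symm⟩

theorem not_isFinitelyBased_sr6 : ¬ (generatedBy SR6.alg.{u}).IsFinitelyBased := by
  rintro ⟨E, hfin, hE⟩
  have hSR : ∀ p ∈ E, SatisfiesIdentity SR6.{u} p := (hE SR6.alg).1 (mem_generatedBy _)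
  have hbound : ∀ p : AITerm × AITerm, ∃ N,
      (∀ x y, p.1.toPoly.Edge x y → x < N ∧ y < N) ∧
      ∀ x y, p.2.toPoly.Edge x y → x < N ∧ y < N := by
    intro p
    obtain ⟨M, -, hM⟩ := p.1.toPoly.exists_bound
    obtain ⟨N, -, hN⟩ := p.2.toPoly.exists_bound
    exact ⟨max M N,
      fun x y h => ⟨lt_max_of_lt_left (hM x y h).1, lt_max_of_lt_left (hM x y h).2⟩,
      fun x y h => ⟨lt_max_of_lt_right (hN x y h).1, lt_max_of_lt_right (hN x y h).2⟩⟩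
  choose f hf using hbound
  obtain ⟨N, hN⟩ := (hfin.image f).bddAbove
  -- The length `2 * (N + 1) + 1` exceeds every variable bound and equals `2 * N + 3`, the cycle
  -- length in `cycleIdentity (2 * N + 1)`.
  have hfN : ∀ p ∈ E, f p < 2 * (N + 1) + 1 := fun p hp => by
    have := hN (Set.mem_image_of_mem f hp)
    omega
  have hmem : GraphAlg.alg.{u} (cycle (2 * (N + 1) + 1)) ∈ (generatedBy SR6.alg.{u}).carrier := by
    rw [hE]
    intro p hp v
    have hp' : ∀ v : ℕ → SR6.{u}, p.1.toPoly.eval v = p.2.toPoly.eval v := fun v => by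
      rw [AITerm.eval_toPoly, AITerm.eval_toPoly, hSR p hp v]
    rw [← AITerm.eval_toPoly, ← AITerm.eval_toPoly]
    exact below_antisymm
      (GraphAlg.eval_below_eval (hfN p hp) (hf p).2 (fun v => (hp' v).symm) v)
      (GraphAlg.eval_below_eval (hfN p hp) (hf p).1 hp' v)
  refine AITerm.not_satisfies_cycleIdentity.{u} N
    (models_of_mem_generatedBy (E := {AITerm.cycleIdentity (2 * N + 1)}) ?_ hmem _ rfl)
  rintro p rfl
  exact AITerm.sr6_satisfies_cycleIdentity N

end AIVariety

theorem mainTheorem1 :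
    (AIVariety.generatedBy SR6.alg.{u}).IsLimit ∧
    (∀ W : AIVariety.{u}, W < AIVariety.generatedBy SR6.alg.{u} ↔
      W = AIVariety.trivial ∨ W = AIVariety.generatedBy ScA.{u} ∨
        W = AIVariety.generatedBy ScAB.{u}) ∧
    AIVariety.trivial < AIVariety.generatedBy ScA.{u} ∧
    AIVariety.generatedBy ScA.{u} < AIVariety.generatedBy ScAB.{u} ∧
    AIVariety.generatedBy ScAB.{u} < AIVariety.generatedBy SR6.alg.{u} := by
  rw [FlatA.generatedBy_ScA, FlatAB.generatedBy_ScAB]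
  have h1 := AIVariety.trivial_lt_flatA.{u}
  have h2 := AIVariety.flatA_lt_flatAB.{u}
  have h3 := AIVariety.flatAB_lt_sr6.{u}
  refine ⟨⟨AIVariety.not_isFinitelyBased_sr6, fun W hW => ?_⟩,
    fun W => ⟨AIVariety.eq_of_lt_sr6, ?_⟩, h1, h2, h3⟩
  · rcases AIVariety.eq_of_lt_sr6 hW with rfl | rfl | rfl
    · rw [AIVariety.trivial_eq_models]
      exact AIVariety.isFinitelyBased_models (Set.finite_singleton _)
    · rw [AIVariety.generatedBy_flatA]
      exact AIVariety.isFinitelyBased_models (AITerm.baseIdentities_finite.insert _)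
    · rw [AIVariety.generatedBy_flatAB]
      exact AIVariety.isFinitelyBased_models (AITerm.baseIdentities_finite.insert _)
  · rintro (rfl | rfl | rfl)
    · exact h1.trans (h2.trans h3)
    · exact h2.trans h3
    · exact h3
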